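/- **Setting.** Let $d=d_x+d_y$, let $\mathcal X\subseteq\mathbb R^{d_x}$ and $\mathcal Y\subseteq\mathbb R^{d_y}$ be compact and convex, $\mathcal Z=\mathcal X\times\mathcal Y\subseteq\mathbb R^d$, and $\tilde D=\max_{z,z'\in\mathcal Z}\|z-z'\|$ (Euclidean norm). Let $\phi_0,\phi_1,\dots,\phi_{d_y}:\mathbb R^{d_x}\to\mathbb R$ be convex on $\mathcal X$, and let $$f(x,y)=\phi_0(x)+\sum_{j=1}^{d_y}y_j\phi_j(x)$$ be the Lagrangian of the problem $\min_{x\in\mathcal X}\phi_0(x)$ subject to $\phi_j(x)\le 0$ for $j=1,\dots,d_y$. Assume that $f(\cdot,y)$ is convex on $\mathcal X$ for every $y\in\mathcal Y$, and let $z^*=(x^*,y^*)\in\mathcal Z$ be a saddle point of $f$ on $\mathcal X\times\mathcal Y$. Put $\Delta(x,y)=f(x,y^*)-f(x^*,y)$ and $\boldsymbol\phi=(\phi_1,\dots,\phi_{d_y})$; $[\cdot]_+$ denotes the componentwise positive part. Let $r_k>0$ ($k\ge 0$) be smoothing radii with $\sum_{k\ge1}r_k=M_1<\infty$, $\sum_{k\ge1}r_k^2=M_2<\infty$,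 and let $\rho\ge r_k$ for all $k$. Assume that for constants $G>0$, $L\ge 0$ the function $f$ is $G$-Lipschitz and differentiable with $L$-Lipschitz gradient on the closed $\rho$-neighbourhood of $\mathcal Z$ (which contains all points at which the algorithm evaluates $f$). **Algorithm (ZOEG).** Let $z_0\in\mathcal Z$, let $v_0,w_0,v_1,w_1,\dots$ be independent and uniformly distributed on the unit sphere of $\mathbb R^d$, and for $v=(v_x,v_y)$ write $\tilde v=(v_x,-v_y)$. With $\mathcal P_{\mathcal Z}$ the Euclidean projection onto $\mathcal Z$ and step size $\eta$, for $k=0,\dots,K-1$ let $$g_k=\frac{f(z_k+r_kv_k)-f(z_k)}{r_k/d}\,\tilde v_k,\qquad z_k^+=\mathcal P_{\mathcal Z}[z_k-\eta g_k],$$ $$g_k^+=\frac{f(z_k^++r_kw_k)-f(z_k^+)}{r_k/d}\,\tilde w_k,\qquad z_{k+1}=\mathcal P_{\mathcal Z}[z_k-\eta g_k^+].$$ The output is $\hat z_K=(\hat x_K,\hat y_K)=\frac1K\sum_{k=0}^{K-1}z_k^+$. **Claim.** Let $\epsilon>0$, let $\eta=\dfrac{\tilde D}{6\sqrt{6dK}\,G}$,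 and let $K\ge1$ be an integer with $$K\ \ge\ \max\left\{\frac{864\,dG^2\tilde D^2}{\epsilon^2},\ \left(\frac{(6d^2+8)^2L^4M_2^2\tilde D^2}{6dG^2\epsilon^2}\right)^{1/3},\ \frac{4LM_1\tilde D}{\epsilon}\right\}.\qquad(*)$$ Then $\Delta(\hat z_K)$, $\phi_0(\hat x_K)$ and $\phi_j(\hat x_K)$ are integrable, and: 1. $\mathbb E[\Delta(\hat z_K)]\le\epsilon$. 2. If $R=\max\{r>0:\ y^*+ru\in\mathcal Y\ \text{for all}\ u\in\mathbb R^{d_y},\ \|u\|=1\}$ exists, then $\big\|\big[\mathbb E[\boldsymbol\phi(\hat x_K)]\big]_+\big\|\le\epsilon/R$. 3. If $0\in\mathcal Y$ and $y^*\ge0$, and $\phi_0^*$ is the optimal value of the constrained problem (the minimum of $\phi_0$ over $\{x\in\mathcal X:\phi_j(x)\le0\ \forall j\ge 1\}$), then $\mathbb E[\phi_0(\hat x_K)]-\phi_0^*\le\epsilon$. Moreover, the oracle complexity is $O(d\epsilon^{-2})$: there is a constant $C$ depending only on $G,L,\tilde D,M_1,M_2$ such that, for every such problem and every $0<\epsilon\le1$,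 some integer $K\ge1$ satisfies $(*)$ and the run of the algorithm with $K$ iterations makes at most $C\,d\,\epsilon^{-2}$ evaluations of $f$. -/

import Mathlib

open MeasureTheory ProbabilityTheory

noncomputable section

namespace ZOEG

/-- The Euclidean space `ℝⁿ`. -/
abbrev Vec (n : ℕ) : Type := EuclideanSpace ℝ (Fin n)

/-- The primal-dual space `ℝ^dx × ℝ^dy = ℝ^(dx+dy)` of points `z = (x, y)`, with the Euclidean
norm `‖z‖² = ‖x‖² + ‖y‖²`; the components of `z` are `z.fst` and `z.snd`. -/
abbrev PD (dx dy : ℕ) : Type := WithLp 2 (Vec dx × Vec dy)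

variable {dx dy : ℕ}

/-- The point `(x, y)` of the primal-dual space. -/
def mk (x : Vec dx) (y : Vec dy) : PD dx dy := WithLp.toLp 2 (x, y)

/-- The set `X × Y` in the primal-dual space. -/
def prodSet (X : Set (Vec dx)) (Y : Set (Vec dy)) : Set (PD dx dy) :=
  {z | z.fst ∈ X ∧ z.snd ∈ Y}

/-- The Lagrangian `f(x, y) = φ₀(x) + ∑ j, y_j φ_j(x)`. -/
def lagrangian (φ₀ : Vec dx → ℝ) (φ : Fin dy → Vec dx → ℝ) (z : PD dx dy) : ℝ :=
  φ₀ z.fst + ∑ j, z.snd j * φ j z.fst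

/-- `f` is `G`-Lipschitz on `N`. -/
def LipschitzFunOn (f : PD dx dy → ℝ) (G : ℝ) (N : Set (PD dx dy)) : Prop :=
  ∀ z₁ ∈ N, ∀ z₂ ∈ N, |f z₁ - f z₂| ≤ G * ‖z₁ - z₂‖

/-- `f` is differentiable at every point of `N`, with an `L`-Lipschitz gradient on `N`. -/
def SmoothFunOn (f : PD dx dy → ℝ) (L : ℝ) (N : Set (PD dx dy)) : Prop :=
  (∀ z ∈ N, DifferentiableAt ℝ f z) ∧
    ∀ z₁ ∈ N, ∀ z₂ ∈ N, ‖gradient f z₁ - gradient f z₂‖ ≤ L * ‖z₁ - z₂‖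

/-- The duality gap `Δ(x, y) = f(x, y*) - f(x*, y)` with respect to the saddle point
`(xs, ys) = (x*, y*)`. -/
def dualityGap (f : PD dx dy → ℝ) (xs : Vec dx) (ys : Vec dy) (z : PD dx dy) : ℝ :=
  f (mk z.fst ys) - f (mk xs z.snd)

/-- The feasible set of the problem `min φ₀(x)` over `x ∈ X` subject to `φ_j(x) ≤ 0` for
all `j`. -/
def feasibleSet (X : Set (Vec dx)) (φ : Fin dy → Vec dx → ℝ) : Set (Vec dx) :=
  {x | x ∈ X ∧ ∀ j, φ j x ≤ 0}

/-- The componentwise positive part of a vector. -/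
def posPart {n : ℕ} (u : Vec n) : Vec n := WithLp.toLp 2 (fun j => max (u j) 0)

/-- The radii `r > 0` such that `ys + r u ∈ Y` for every unit vector `u`. -/
def innerRadii (Y : Set (Vec dy)) (ys : Vec dy) : Set ℝ :=
  {r | 0 < r ∧ ∀ u : Vec dy, ‖u‖ = 1 → ys + r • u ∈ Y}

/-- The Euclidean projection onto `Z`: a point of `Z` nearest to `z` (there is exactly one when
`Z` is nonempty, closed and convex). -/
def proj (Z : Set (PD dx dy)) (z : PD dx dy) : PD dx dy :=
  Classical.epsilon fun p => p ∈ Z ∧ ∀ q ∈ Z, ‖z - p‖ ≤ ‖z - q‖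

/-- The uniform distribution on the unit sphere of `ℝ^(dx+dy)`: the normalized surface measure,
seen as a measure on the whole space. -/
def uniformSphere (dx dy : ℕ) : Measure (PD dx dy) :=
  (((volume : Measure (PD dx dy)).toSphere Set.univ)⁻¹ •
    (volume : Measure (PD dx dy)).toSphere).map Subtype.val

/-! ### Algorithms with access to a function-value oracle -/

/-- A procedure that may adaptively query the value of a black-box function at points of `E`,
and that finally returns an element of `α`. -/
inductive OracleProg (E : Type) (α : Type) : Type
  | ret : α → OracleProg E α
  | query : E → (ℝ → OracleProg E α) → OracleProg E α

namespace OracleProg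

variable {E α β : Type}

/-- Run one procedure after the other. -/
def bind : OracleProg E α → (α → OracleProg E β) → OracleProg E β
  | ret a, k => k a
  | query z c, k => query z fun t => bind (c t) k

/-- The result of the procedure when the oracle answers with the values of `f`. -/
def result (f : E → ℝ) : OracleProg E α → α
  | ret a => a
  | query z c => result f (c (f z))

/-- The number of oracle queries made when the oracle answers with the values of `f`. -/
def queries (f : E → ℝ) : OracleProg E α → ℕ
  | ret _ => 0
  | query z c => queries f (c (f z)) + 1

end OracleProg

/-! ### The zeroth-order extra-gradient algorithm -/

/-- The two-point gradient estimator `((a - b) / (r / d)) ṽ` with `ṽ = (v_x, -v_y)`, built from the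
function values `a = f(z + r v)` and `b = f(z)`, where `d = dx + dy`. -/
def estimator (r : ℝ) (v : PD dx dy) (a b : ℝ) : PD dx dy :=
  ((a - b) / (r / ((dx + dy : ℕ) : ℝ))) • mk v.fst (-v.snd)

/-- One iteration from `z_k = z`, with perturbations `v` and `w`. It returns the pair
`(z_k⁺, z_{k+1})`, where `z_k⁺ = P_Z[z_k - η g_k]` and `z_{k+1} = P_Z[z_k - η g_k⁺]`. -/
def step (Z : Set (PD dx dy)) (η r : ℝ) (v w z : PD dx dy) :
    OracleProg (PD dx dy) (PD dx dy × PD dx dy) :=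
  .query (z + r • v) fun a =>
  .query z fun b =>
  let zp := proj Z (z - η • estimator r v a b)
  .query (zp + r • w) fun a' =>
  .query zp fun b' =>
  .ret (zp, proj Z (z - η • estimator r w a' b'))

/-- The first `k` iterations from `z₀`; returns `(z_k, ∑_{i < k} z_i⁺)`. -/
def loop (Z : Set (PD dx dy)) (η : ℝ) (r : ℕ → ℝ) (z₀ : PD dx dy) (v w : ℕ → PD dx dy) :
    ℕ → OracleProg (PD dx dy) (PD dx dy × PD dx dy)
  | 0 => .ret (z₀, 0)
  | k + 1 =>
      (loop Z η r z₀ v w k).bind fun p =>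
      (step Z η (r k) (v k) (w k) p.1).bind fun q =>
      .ret (q.2, p.2 + q.1)

/-- The zeroth-order extra-gradient algorithm with `K` iterations, step size `η`, smoothing radii
`r`, initial point `z₀` and sampled perturbations `v`, `w`; it returns the average
`(1/K) ∑_{k < K} z_k⁺`. -/
def zoeg (Z : Set (PD dx dy)) (η : ℝ) (r : ℕ → ℝ) (z₀ : PD dx dy) (v w : ℕ → PD dx dy) (K : ℕ) :
    OracleProg (PD dx dy) (PD dx dy) :=
  (loop Z η r z₀ v w K).bind fun p => .ret ((K : ℝ)⁻¹ • p.2)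

/-- The step size `η = D / (6 √(6 d K) G)`. -/
def stepSize (d K : ℕ) (G D : ℝ) : ℝ := D / (6 * √(6 * d * K) * G)

/-- The lower bound required of the number of iterations. -/
def iterBound (d : ℕ) (G L D M₁ M₂ ε : ℝ) : ℝ :=
  max (max (864 * d * G ^ 2 * D ^ 2 / ε ^ 2)
    (((6 * (d : ℝ) ^ 2 + 8) ^ 2 * L ^ 4 * M₂ ^ 2 * D ^ 2 / (6 * d * G ^ 2 * ε ^ 2)) ^ (1 / 3 : ℝ)))
    (4 * L * M₁ * D / ε)

end ZOEG

end

/-! For a fixed comparison point `u = (u_x, u_y)` in `Z`, put gap(z) = f(x, u_y) - f(u_x, y). The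
core is `integral_gap_average_le`: the averaged output has expected gap at most `ε` for every such
`u`. The three guarantees come from three deterministic choices of `u`: the saddle point itself;
(x*, y* + R q/‖q‖) with q the positive part of the expected constraint vector; and (x*, 0).

Convexity in x and linearity in y bound the gap at z by ⟪∇f(z), reflected (z - u)⟫. The two-point
estimator replaces this gradient at two costs. Its bias is at most 2Lr‖z - u‖, free of the
dimension: the linear part of f is reproduced exactly because a uniform unit vector has covariance
I/d, and the Taylor remainder is handled by integration by parts on the sphere
(`integral_inner_mul_eq`), which trades the factor d - 1 for one derivative. Its second moment is at
most 2dG² + 2d²L²r², linear in d up to a term summable over the iterations.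

The extra-gradient inequality (`extragradient_inequality`) holds for arbitrary vectors a, b in place
of the two scaled estimators, at the price ‖b - a‖²/2, which the two second moments control. Since
w_k is independent of z_k⁺, and v_k of z_k, taking expectations gives a recursion
(`integral_gap_iteratePlus_le`) whose squared distances telescope. The sums M₁ and M₂ leave out r_0,
so iteration 0 is charged the trivial bound GD. Jensen passes to the average, and `stepSize_budget`
checks that the errors fit into `ε`.

As f is regular only near `Z`, measurability and integrability are obtained by running the algorithm
on a globally Lipschitz extension `h` of f, with perturbations modified on a null set to have norm
one everywhere. -/

namespace ZOEG

noncomputable section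

open scoped InnerProductSpace RealInnerProductSpace Pointwise

/-! ### Rotation invariance and integration by parts on the sphere -/

section Sphere

variable {E : Type*} [NormedAddCommGroup E] [InnerProductSpace ℝ E]

/-- The one-parameter group of isometries generated by a skew-symmetric map. -/
theorem exists_isometry_flow [FiniteDimensional ℝ E] (A : E →L[ℝ] E)
    (hA : ∀ x y, ⟪A x, y⟫_ℝ = -⟪x, A y⟫_ℝ) :
    ∃ R : ℝ → E ≃ₗᵢ[ℝ] E, (∀ v, R 0 v = v) ∧
      ∀ t v, HasDerivAt (fun s => R s v) (R t (A v)) t := by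
  have hskew : ∀ t : ℝ, t • A ∈ skewAdjoint (E →L[ℝ] E) := by
    intro t
    rw [skewAdjoint.mem_iff, ContinuousLinearMap.star_eq_adjoint]
    symm
    rw [ContinuousLinearMap.eq_adjoint_iff]
    intro x y
    simp [inner_smul_left, inner_smul_right, hA]
  let _ : NormedAlgebra ℚ (E →L[ℝ] E) := NormedAlgebra.restrictScalars ℚ ℝ _
  -- The flow is exp(tA), orthogonal because tA is skew-adjoint.
  refine ⟨fun t => Unitary.linearIsometryEquiv
    ⟨NormedSpace.exp (t • A), NormedSpace.exp_mem_unitary_of_mem_skewAdjoint (hskew t)⟩, ?_, ?_⟩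
  · intro v
    simp [Unitary.linearIsometryEquiv]
  · intro t v
    exact ((hasDerivAt_exp_smul_const (𝕂 := ℝ) A t).clm_apply (hasDerivAt_const t v)).congr_deriv
      (by simp [Unitary.linearIsometryEquiv])

variable [MeasurableSpace E]

/-- A rotation invariant probability measure carried by the unit sphere. -/
structure IsRotationInvariantOnSphere (μ : Measure E) : Prop where
  isProbabilityMeasure : IsProbabilityMeasure μ
  norm_eq_one : ∀ᵐ v ∂μ, ‖v‖ = 1
  measurePreserving : ∀ R : E ≃ₗᵢ[ℝ] E, MeasurePreserving R μ μ

theorem integrable_of_bound_on_sphere {μ : Measure E} (hμ : IsRotationInvariantOnSphere μ)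
    {q : E → ℝ} (hq : AEStronglyMeasurable q μ) {C : ℝ} (hC : ∀ v, ‖v‖ = 1 → |q v| ≤ C) :
    Integrable q μ := by
  have := hμ.isProbabilityMeasure
  refine Integrable.of_bound hq C ?_
  filter_upwards [hμ.norm_eq_one] with v hv using hC v hv

variable [BorelSpace E]

theorem aestronglyMeasurable_of_continuousOn_sphere {μ : Measure E}
    (hμ : IsRotationInvariantOnSphere μ) {q : E → ℝ}
    (hq : ContinuousOn q (Metric.sphere 0 1)) : AEStronglyMeasurable q μ := by
  have h1 : μ.restrict (Metric.sphere 0 1) = μ := by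
    refine Measure.restrict_eq_self_of_ae_mem ?_
    filter_upwards [hμ.norm_eq_one] with v hv
    simpa using hv
  rw [← h1]
  exact hq.aestronglyMeasurable (Metric.isClosed_sphere.measurableSet)

variable [FiniteDimensional ℝ E]

/-- A function on the sphere has mean derivative zero along an infinitesimal rotation. -/
theorem integral_fderiv_skew_eq_zero {μ : Measure E} (hμ : IsRotationInvariantOnSphere μ)
    (A : E →L[ℝ] E) (hA : ∀ x y, ⟪A x, y⟫_ℝ = -⟪x, A y⟫_ℝ) {q : E → ℝ} {C : ℝ} (hC : 0 ≤ C)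
    (hLip : ∀ v w, ‖v‖ = 1 → ‖w‖ = 1 → |q v - q w| ≤ C * ‖v - w‖)
    (hd : ∀ v, ‖v‖ = 1 → DifferentiableAt ℝ q v) :
    Integrable (fun v => fderiv ℝ q v (A v)) μ ∧ ∫ v, fderiv ℝ q v (A v) ∂μ = 0 := by
  have := hμ.isProbabilityMeasure
  obtain ⟨R, hR0, hR⟩ := exists_isometry_flow A hA
  have hcont : ContinuousOn q (Metric.sphere 0 1) := fun v hv =>
    (hd v (by simpa using hv)).continuousAt.continuousWithinAt
  have hmeas := aestronglyMeasurable_of_continuousOn_sphere hμ hcont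
  have hint : Integrable q μ := by
    obtain ⟨B, hB⟩ := (isCompact_sphere (0 : E) 1).exists_bound_of_continuousOn hcont
    exact integrable_of_bound_on_sphere hμ hmeas fun v hv => hB v (by simpa using hv)
  have hflow : ∀ v t s, ‖R t v - R s v‖ ≤ ‖A v‖ * |t - s| := by
    intro v t s
    have := Convex.norm_image_sub_le_of_norm_hasDerivWithin_le (f := fun s => R s v)
      (f' := fun s => R s (A v)) (C := ‖A v‖) (s := Set.univ) (x := s) (y := t)
      (fun x _ => (hR x v).hasDerivWithinAt) (fun x _ => by simp) convex_univ trivial trivial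
    simpa using this
  -- By invariance t ↦ ∫ q(R t v) is constant; its derivative at 0, taken under the integral, is the
  -- claimed one. The flow keeps the sphere, so the Lipschitz bound there dominates the difference
  -- quotients.
  have key := hasDerivAt_integral_of_dominated_loc_of_lip (μ := μ) (x₀ := (0 : ℝ))
    (F := fun t v => q (R t v)) (F' := fun v => fderiv ℝ q v (A v))
    (bound := fun _ => C * ‖A‖) (s := Set.univ) Filter.univ_mem
    (Filter.Eventually.of_forall fun t =>
      hmeas.comp_measurePreserving (hμ.measurePreserving (R t)))
    (by simpa [hR0] using hint)
    ?_ ?_ (integrable_const _) ?_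
  · refine ⟨key.1, ?_⟩
    have h1 : (fun t => ∫ v, q (R t v) ∂μ) = fun _ => ∫ v, q v ∂μ := by
      funext t
      exact (hμ.measurePreserving (R t)).integral_comp
        (R t).toHomeomorph.measurableEmbedding q
    rw [h1] at key
    exact key.2.unique (hasDerivAt_const _ _)
  · exact isBoundedBilinearMap_apply.continuous.comp_aestronglyMeasurable
      ((measurable_fderiv ℝ q).aestronglyMeasurable.prodMk A.continuous.aestronglyMeasurable)
  · filter_upwards [hμ.norm_eq_one] with v hv
    refine LipschitzOnWith.of_dist_le_mul fun t _ s _ => ?_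
    have hCA : 0 ≤ C * ‖A‖ := by positivity
    rw [Real.dist_eq, Real.dist_eq, Real.coe_nnabs, abs_of_nonneg hCA]
    calc |q (R t v) - q (R s v)| ≤ C * ‖R t v - R s v‖ := hLip _ _ (by simp [hv]) (by simp [hv])
      _ ≤ C * (‖A‖ * |t - s|) := by
          gcongr
          refine (hflow v t s).trans ?_
          gcongr
          simpa [hv] using A.le_opNorm v
      _ = _ := by ring
  · filter_upwards [hμ.norm_eq_one] with v hv
    have h1 := hR 0 v
    rw [hR0] at h1
    have h2 : HasFDerivAt q (fderiv ℝ q v) (R 0 v) := by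
      rw [hR0]; exact (hd v hv).hasFDerivAt
    exact h2.comp_hasDerivAt (0 : ℝ) h1

/-- Integration by parts on the sphere, against linear functions. -/
theorem integral_inner_mul_eq {μ : Measure E} (hμ : IsRotationInvariantOnSphere μ) (a : E)
    {q : E → ℝ} {C : ℝ} (hC : 0 ≤ C)
    (hLip : ∀ v w, ‖v‖ = 1 → ‖w‖ = 1 → |q v - q w| ≤ C * ‖v - w‖)
    (hd : ∀ v, ‖v‖ = 1 → DifferentiableAt ℝ q v) :
    ((Module.finrank ℝ E : ℝ) - 1) * ∫ v, ⟪a, v⟫_ℝ * q v ∂μ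
      = ∫ v, fderiv ℝ q v (a - ⟪a, v⟫_ℝ • v) ∂μ := by
  have := hμ.isProbabilityMeasure
  have hcont : ContinuousOn q (Metric.sphere 0 1) := fun v hv =>
    (hd v (by simpa using hv)).continuousAt.continuousWithinAt
  obtain ⟨B, hB⟩ := (isCompact_sphere (0 : E) 1).exists_bound_of_continuousOn hcont
  replace hB : ∀ v : E, ‖v‖ = 1 → |q v| ≤ B := fun v hv => hB v (by simpa using hv)
  let e := stdOrthonormalBasis ℝ E
  -- `A j` generates the rotations in the plane of a and e_j. Applied to ⟪e_j, v⟫ q(v) and summed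
  -- over j, the terms without derivative of q add up to (n - 1)⟪a, v⟫ q(v), and the others to minus
  -- the derivative of q along the tangential part of a.
  let A : Fin (Module.finrank ℝ E) → E →L[ℝ] E := fun j =>
    (innerSL ℝ a).smulRight (e j) - (innerSL ℝ (e j)).smulRight a
  have hAapp : ∀ j v, A j v = ⟪a, v⟫_ℝ • e j - ⟪e j, v⟫_ℝ • a := fun j v => by simp [A]
  have hA : ∀ j x y, ⟪A j x, y⟫_ℝ = -⟪x, A j y⟫_ℝ := by
    intro j x y
    simp only [hAapp, inner_sub_left, inner_sub_right, inner_smul_left, inner_smul_right,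
      RCLike.conj_to_real, real_inner_comm x]
    ring
  have hder : ∀ j v, ‖v‖ = 1 → fderiv ℝ (fun v => ⟪e j, v⟫_ℝ * q v) v (A j v)
      = (⟪a, v⟫_ℝ - ⟪e j, v⟫_ℝ * ⟪e j, a⟫_ℝ) * q v
        + ⟪e j, v⟫_ℝ * fderiv ℝ q v (A j v) := by
    intro j v hv
    have h1 : HasFDerivAt (fun v => ⟪e j, v⟫_ℝ) (innerSL ℝ (e j)) v :=
      (innerSL ℝ (e j)).hasFDerivAt
    rw [show fderiv ℝ (fun v => ⟪e j, v⟫_ℝ * q v) v = _ from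
      (h1.mul (hd v hv).hasFDerivAt).fderiv]
    have h2 : ⟪e j, A j v⟫_ℝ = ⟪a, v⟫_ℝ - ⟪e j, v⟫_ℝ * ⟪e j, a⟫_ℝ := by
      rw [hAapp, inner_sub_right, inner_smul_right, inner_smul_right]
      simp
    simp only [add_apply, smul_apply, innerSL_apply_apply, smul_eq_mul, h2]
    ring
  have hj : ∀ j, Integrable (fun v => fderiv ℝ (fun v => ⟪e j, v⟫_ℝ * q v) v (A j v)) μ ∧
      ∫ v, fderiv ℝ (fun v => ⟪e j, v⟫_ℝ * q v) v (A j v) ∂μ = 0 := by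
    intro j
    refine integral_fderiv_skew_eq_zero hμ (A j) (hA j) (C := |B| + C) (by positivity) ?_ ?_
    · intro v w hv hw
      have h1 : |⟪e j, v - w⟫_ℝ| ≤ ‖v - w‖ := by
        simpa using abs_real_inner_le_norm (e j) (v - w)
      have h2 : |⟪e j, w⟫_ℝ| ≤ 1 := by
        simpa [hw] using abs_real_inner_le_norm (e j) w
      have h3 : ⟪e j, v⟫_ℝ * q v - ⟪e j, w⟫_ℝ * q w
          = ⟪e j, v - w⟫_ℝ * q v + ⟪e j, w⟫_ℝ * (q v - q w) := by
        rw [inner_sub_right]; ring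
      rw [h3]
      calc _ ≤ |⟪e j, v - w⟫_ℝ| * |q v| + |⟪e j, w⟫_ℝ| * |q v - q w| := by
            rw [← abs_mul, ← abs_mul]; exact abs_add_le _ _
        _ ≤ ‖v - w‖ * |B| + 1 * (C * ‖v - w‖) := by
            exact add_le_add
              (mul_le_mul h1 ((hB v hv).trans (le_abs_self B)) (abs_nonneg _) (norm_nonneg _))
              (mul_le_mul h2 (hLip v w hv hw) (abs_nonneg _) zero_le_one)
        _ = _ := by ring
    · intro v hv
      exact ((innerSL ℝ (e j)).differentiableAt).mul (hd v hv)
  have hsum : ∫ v, ∑ j, fderiv ℝ (fun v => ⟪e j, v⟫_ℝ * q v) v (A j v) ∂μ = 0 := by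
    rw [integral_finsetSum _ fun j _ => (hj j).1]
    exact Finset.sum_eq_zero fun j _ => (hj j).2
  have hpt : ∀ v, ‖v‖ = 1 → ∑ j, fderiv ℝ (fun v => ⟪e j, v⟫_ℝ * q v) v (A j v)
      = ((Module.finrank ℝ E : ℝ) - 1) * (⟪a, v⟫_ℝ * q v)
        - fderiv ℝ q v (a - ⟪a, v⟫_ℝ • v) := by
    intro v hv
    have h1 : ∑ j, ⟪e j, v⟫_ℝ * ⟪e j, a⟫_ℝ = ⟪a, v⟫_ℝ := by
      have := e.sum_inner_mul_inner a v
      rw [← this]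
      exact Finset.sum_congr rfl fun j _ => by rw [real_inner_comm (e j) a]; ring
    have h2 : ∑ j, ⟪e j, v⟫_ℝ • A j v = ⟪a, v⟫_ℝ • v - a := by
      have h3 : ∑ j, ⟪e j, v⟫_ℝ • e j = v := e.sum_repr' v
      have h4 : ∑ j, ⟪e j, v⟫_ℝ * ⟪e j, v⟫_ℝ = 1 := by
        have := e.sum_inner_mul_inner v v
        rw [real_inner_self_eq_norm_sq, hv] at this
        rw [← one_pow 2, ← this]
        exact Finset.sum_congr rfl fun j _ => by rw [real_inner_comm (e j) v]
      simp only [hAapp, smul_sub, Finset.sum_sub_distrib]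
      congr 1
      · conv_rhs => rw [← h3, Finset.smul_sum]
        rw [h3]
        exact Finset.sum_congr rfl fun j _ => smul_comm _ _ _
      · simp only [smul_smul]
        rw [← Finset.sum_smul, h4, one_smul]
    rw [Finset.sum_congr rfl fun j _ => hder j v hv, Finset.sum_add_distrib, ← Finset.sum_mul,
      Finset.sum_sub_distrib, h1]
    have h5 : ∑ j, ⟪e j, v⟫_ℝ * fderiv ℝ q v (A j v) = fderiv ℝ q v (⟪a, v⟫_ℝ • v - a) := by
      rw [← h2, map_sum]
      exact Finset.sum_congr rfl fun j _ => by rw [map_smul, smul_eq_mul]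
    rw [h5]
    simp only [map_sub, Finset.sum_const, Finset.card_univ, Fintype.card_fin, nsmul_eq_mul]
    ring
  have hint1 : Integrable (fun v => ⟪a, v⟫_ℝ * q v) μ := by
    refine integrable_of_bound_on_sphere hμ (C := ‖a‖ * B)
      ((innerSL ℝ a).continuous.aestronglyMeasurable.mul
        (aestronglyMeasurable_of_continuousOn_sphere hμ hcont)) fun v hv => ?_
    rw [abs_mul]
    have := abs_real_inner_le_norm a v
    rw [hv, mul_one] at this
    exact mul_le_mul this (hB v hv) (abs_nonneg _) (norm_nonneg _)
  have hae : (fun v => ∑ j, fderiv ℝ (fun v => ⟪e j, v⟫_ℝ * q v) v (A j v)) =ᵐ[μ]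
      fun v => ((Module.finrank ℝ E : ℝ) - 1) * (⟪a, v⟫_ℝ * q v)
        - fderiv ℝ q v (a - ⟪a, v⟫_ℝ • v) := by
    filter_upwards [hμ.norm_eq_one] with v hv using hpt v hv
  have hint0 : Integrable (fun v => ∑ j, fderiv ℝ (fun v => ⟪e j, v⟫_ℝ * q v) v (A j v)) μ :=
    integrable_finsetSum _ fun j _ => (hj j).1
  -- Integrability is read off the pointwise identity, whose other two terms are integrable.
  have hint2 : Integrable (fun v => fderiv ℝ q v (a - ⟪a, v⟫_ℝ • v)) μ := by
    have := (hint1.const_mul ((Module.finrank ℝ E : ℝ) - 1)).sub (hint0.congr hae)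
    refine this.congr (Filter.Eventually.of_forall fun v => ?_)
    simp
  rw [integral_congr_ae hae, integral_sub (hint1.const_mul _) hint2, integral_const_mul] at hsum
  linarith

/-- The covariance of a rotation invariant random unit vector. -/
theorem integral_inner_mul_inner {μ : Measure E} (hμ : IsRotationInvariantOnSphere μ) (a c : E) :
    (Module.finrank ℝ E : ℝ) * ∫ v, ⟪a, v⟫_ℝ * ⟪c, v⟫_ℝ ∂μ = ⟪a, c⟫_ℝ := by
  have := hμ.isProbabilityMeasure
  -- For linear q the right-hand side is ⟪a, c⟫ minus the integral sought, which turns n - 1 into n.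
  have h := integral_inner_mul_eq hμ a (q := fun v => ⟪c, v⟫_ℝ) (C := ‖c‖) (norm_nonneg c)
    (fun v w _ _ => by rw [← inner_sub_right]; exact abs_real_inner_le_norm _ _)
    (fun v _ => (innerSL ℝ c).differentiableAt)
  have hf : ∀ v, fderiv ℝ (fun v => ⟪c, v⟫_ℝ) v = innerSL ℝ c := fun v =>
    (innerSL ℝ c).hasFDerivAt.fderiv
  have hint : Integrable (fun v => ⟪a, v⟫_ℝ * ⟪c, v⟫_ℝ) μ := by
    refine integrable_of_bound_on_sphere hμ (C := ‖a‖ * ‖c‖)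
      (by fun_prop) fun v hv => ?_
    rw [abs_mul]
    have h1 := abs_real_inner_le_norm a v
    have h2 := abs_real_inner_le_norm c v
    rw [hv, mul_one] at h1 h2
    gcongr
  simp only [hf, innerSL_apply_apply, inner_sub_right, inner_smul_right] at h
  rw [integral_sub (integrable_const _) hint] at h
  simp only [integral_const, probReal_univ, smul_eq_mul, one_mul] at h
  rw [real_inner_comm]
  linarith

end Sphere

/-- Surface measure of a set is proportional to the volume of the cone over it; isometries commute
with forming cones and preserve volume. -/
theorem isRotationInvariantOnSphere_uniformSphere {dx dy : ℕ}
    (h : IsProbabilityMeasure (uniformSphere dx dy)) :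
    IsRotationInvariantOnSphere (uniformSphere dx dy) := by
  have hemb : Measurable (Subtype.val : Metric.sphere (0 : PD dx dy) 1 → PD dx dy) :=
    measurable_subtype_coe
  refine ⟨h, ?_, fun R => ⟨R.continuous.measurable, ?_⟩⟩
  · rw [uniformSphere, ae_map_iff hemb.aemeasurable
      (measurableSet_eq_fun measurable_norm measurable_const)]
    exact Filter.Eventually.of_forall fun v => by simp
  · ext s hs
    have hRs : MeasurableSet (R ⁻¹' s) := R.continuous.measurable hs
    rw [Measure.map_apply R.continuous.measurable hs, uniformSphere, Measure.map_apply hemb hs,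
      Measure.map_apply hemb hRs, Measure.smul_apply, Measure.smul_apply,
      Measure.toSphere_apply' _ (hemb hs), Measure.toSphere_apply' _ (hemb hRs)]
    have : Set.Ioo (0 : ℝ) 1 • ((Subtype.val : Metric.sphere (0 : PD dx dy) 1 → PD dx dy) ''
          (Subtype.val ⁻¹' (R ⁻¹' s)))
        = R ⁻¹' (Set.Ioo (0 : ℝ) 1 • ((Subtype.val : Metric.sphere (0 : PD dx dy) 1 → PD dx dy) ''
          (Subtype.val ⁻¹' s))) := by
      ext x
      simp only [Subtype.image_preimage_coe, Set.mem_smul, Set.mem_inter_iff, Set.mem_preimage,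
        mem_sphere_zero_iff_norm]
      constructor
      · rintro ⟨t, ht, y, ⟨hy, hys⟩, rfl⟩
        exact ⟨t, ht, R y, ⟨by simpa using hy, hys⟩, by simp⟩
      · rintro ⟨t, ht, y, ⟨hy, hys⟩, hxy⟩
        refine ⟨t, ht, R.symm y, ⟨by simpa using hy, by simpa using hys⟩, ?_⟩
        rw [← map_smul, hxy, R.symm_apply_apply]
    rw [this, R.measurePreserving.measure_preimage_emb R.toHomeomorph.measurableEmbedding]

/-! ### Bias and second moment of the two-point estimator -/

section Estimator

variable {E : Type*} [NormedAddCommGroup E] [InnerProductSpace ℝ E]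
  {f : E → ℝ} {z : E} {r L : ℝ}

theorem add_smul_mem_closedBall (hr : 0 ≤ r) {v : E} (hv : ‖v‖ ≤ 1) :
    z + r • v ∈ Metric.closedBall z r := by
  rw [mem_closedBall_iff_norm, add_sub_cancel_left, norm_smul, Real.norm_of_nonneg hr]
  exact mul_le_of_le_one_right hr hv

variable [FiniteDimensional ℝ E]

/-- The first-order Taylor remainder `f (z + r v) - f z - r ⟪∇ f z, v⟫`. -/
def taylorRemainder (f : E → ℝ) (z : E) (r : ℝ) (v : E) : ℝ :=
  f (z + r • v) - f z - r * ⟪gradient f z, v⟫_ℝ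

theorem hasFDerivAt_taylorRemainder {v : E} (hd : DifferentiableAt ℝ f (z + r • v)) :
    HasFDerivAt (taylorRemainder f z r)
      (r • innerSL ℝ (gradient f (z + r • v) - gradient f z)) v := by
  have h1 : HasFDerivAt (fun v : E => z + r • v) (r • ContinuousLinearMap.id ℝ E) v :=
    ((hasFDerivAt_id v).const_smul r).const_add z
  have h2 : HasFDerivAt (fun v : E => f (z + r • v))
      ((innerSL ℝ (gradient f (z + r • v))).comp (r • ContinuousLinearMap.id ℝ E)) v :=
    HasFDerivAt.comp v hd.hasGradientAt.hasFDerivAt h1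
  have h3 : HasFDerivAt (fun v : E => r * ⟪gradient f z, v⟫_ℝ)
      (r • innerSL ℝ (gradient f z)) v :=
    ((innerSL ℝ (gradient f z)).hasFDerivAt).const_mul r
  refine ((h2.sub_const (f z)).sub h3).congr_fderiv ?_
  ext w
  simp [mul_sub]

theorem norm_fderiv_taylorRemainder_le (hr : 0 ≤ r) {v : E}
    (hL : ‖gradient f (z + r • v) - gradient f z‖ ≤ L * r) :
    ‖r • innerSL ℝ (gradient f (z + r • v) - gradient f z)‖ ≤ L * r ^ 2 := by
  rw [norm_smul, Real.norm_of_nonneg hr, innerSL_apply_norm]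
  calc _ ≤ r * (L * r) := by gcongr
    _ = _ := by ring

theorem abs_taylorRemainder_sub_le (hr : 0 ≤ r)
    (hd : ∀ x ∈ Metric.closedBall z r, DifferentiableAt ℝ f x)
    (hL : ∀ x ∈ Metric.closedBall z r, ‖gradient f x - gradient f z‖ ≤ L * r)
    {v w : E} (hv : ‖v‖ ≤ 1) (hw : ‖w‖ ≤ 1) :
    |taylorRemainder f z r v - taylorRemainder f z r w| ≤ L * r ^ 2 * ‖v - w‖ := by
  refine Convex.norm_image_sub_le_of_norm_hasFDerivWithin_le (s := Metric.closedBall (0 : E) 1)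
    (f' := fun v => r • innerSL ℝ (gradient f (z + r • v) - gradient f z))
    (fun x hx => (hasFDerivAt_taylorRemainder
      (hd _ (add_smul_mem_closedBall hr (by simpa using hx)))).hasFDerivWithinAt)
    (fun x hx => norm_fderiv_taylorRemainder_le hr
      (hL _ (add_smul_mem_closedBall hr (by simpa using hx))))
    (convex_closedBall 0 1) (by simpa using hw) (by simpa using hv)

theorem abs_taylorRemainder_le (hr : 0 ≤ r) (hL0 : 0 ≤ L)
    (hd : ∀ x ∈ Metric.closedBall z r, DifferentiableAt ℝ f x)
    (hL : ∀ x ∈ Metric.closedBall z r, ‖gradient f x - gradient f z‖ ≤ L * r)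
    {v : E} (hv : ‖v‖ ≤ 1) : |taylorRemainder f z r v| ≤ L * r ^ 2 := by
  have h := abs_taylorRemainder_sub_le hr hd hL hv (w := 0) (by simp)
  have h0 : taylorRemainder f z r 0 = 0 := by simp [taylorRemainder]
  rw [h0, sub_zero, sub_zero] at h
  exact h.trans (mul_le_of_le_one_right (by positivity) hv)

variable [MeasurableSpace E] [BorelSpace E] {μ : Measure E}

/-- Bounding the integrand by its supremum would leave a factor n. Instead n is split as (n - 1) +
1: the first part becomes, by integration by parts, the mean of a tangential derivative, and the
second is bounded directly. Each is at most L r² ‖a‖, hence the 2. -/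
theorem abs_integral_inner_mul_taylorRemainder_le (hμ : IsRotationInvariantOnSphere μ)
    (hr : 0 ≤ r) (hL0 : 0 ≤ L)
    (hd : ∀ x ∈ Metric.closedBall z r, DifferentiableAt ℝ f x)
    (hL : ∀ x ∈ Metric.closedBall z r, ‖gradient f x - gradient f z‖ ≤ L * r) (a : E) :
    |Module.finrank ℝ E * ∫ v, ⟪a, v⟫_ℝ * taylorRemainder f z r v ∂μ|
      ≤ 2 * (L * r ^ 2 * ‖a‖) := by
  have := hμ.isProbabilityMeasure
  have hder : ∀ v : E, ‖v‖ = 1 → HasFDerivAt (taylorRemainder f z r)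
      (r • innerSL ℝ (gradient f (z + r • v) - gradient f z)) v := fun v hv =>
    hasFDerivAt_taylorRemainder (hd _ (add_smul_mem_closedBall hr hv.le))
  have hibp := integral_inner_mul_eq hμ a (q := taylorRemainder f z r) (C := L * r ^ 2)
    (by positivity) (fun v w hv hw => abs_taylorRemainder_sub_le hr hd hL hv.le hw.le)
    (fun v hv => (hder v hv).differentiableAt)
  have h1 : |∫ v, fderiv ℝ (taylorRemainder f z r) v (a - ⟪a, v⟫_ℝ • v) ∂μ|
      ≤ L * r ^ 2 * ‖a‖ := by
    have := norm_integral_le_of_norm_le_const (μ := μ) (C := L * r ^ 2 * ‖a‖)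
      (f := fun v => fderiv ℝ (taylorRemainder f z r) v (a - ⟪a, v⟫_ℝ • v)) ?_
    · simpa using this
    filter_upwards [hμ.norm_eq_one] with v hv
    rw [(hder v hv).fderiv]
    refine (ContinuousLinearMap.le_opNorm _ _).trans ?_
    have h2 := norm_fderiv_taylorRemainder_le hr
      (hL _ (add_smul_mem_closedBall hr hv.le))
    have h3 : ‖a - ⟪a, v⟫_ℝ • v‖ ≤ ‖a‖ := by
      refine le_of_sq_le_sq ?_ (norm_nonneg a)
      rw [norm_sub_sq_real, inner_smul_right, norm_smul, hv, Real.norm_eq_abs, mul_one, sq_abs]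
      nlinarith [sq_nonneg ⟪a, v⟫_ℝ]
    exact mul_le_mul h2 h3 (norm_nonneg _) (by positivity)
  have h2 : |∫ v, ⟪a, v⟫_ℝ * taylorRemainder f z r v ∂μ| ≤ L * r ^ 2 * ‖a‖ := by
    have := norm_integral_le_of_norm_le_const (μ := μ) (C := L * r ^ 2 * ‖a‖)
      (f := fun v => ⟪a, v⟫_ℝ * taylorRemainder f z r v) ?_
    · simpa using this
    filter_upwards [hμ.norm_eq_one] with v hv
    have h3 := abs_real_inner_le_norm a v
    rw [hv, mul_one] at h3
    rw [norm_mul, mul_comm]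
    exact mul_le_mul (abs_taylorRemainder_le hr hL0 hd hL hv.le) h3 (norm_nonneg _)
      (by positivity)
  rw [← hibp] at h1
  calc _ = |((Module.finrank ℝ E : ℝ) - 1) * ∫ v, ⟪a, v⟫_ℝ * taylorRemainder f z r v ∂μ
        + ∫ v, ⟪a, v⟫_ℝ * taylorRemainder f z r v ∂μ| := by congr 1; ring
    _ ≤ _ := abs_add_le _ _
    _ ≤ _ := by linarith

theorem aestronglyMeasurable_taylorRemainder (hμ : IsRotationInvariantOnSphere μ) (hr : 0 ≤ r)
    (hd : ∀ x ∈ Metric.closedBall z r, DifferentiableAt ℝ f x) :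
    AEStronglyMeasurable (taylorRemainder f z r) μ :=
  aestronglyMeasurable_of_continuousOn_sphere hμ fun v hv =>
    (hasFDerivAt_taylorRemainder (hd _ (add_smul_mem_closedBall hr
      (by simp at hv; exact hv.le)))).continuousAt.continuousWithinAt

/-- The bias of the two-point estimator of the gradient. -/
theorem abs_integral_two_point_sub_le (hμ : IsRotationInvariantOnSphere μ)
    (hr : 0 < r) (hL0 : 0 ≤ L)
    (hd : ∀ x ∈ Metric.closedBall z r, DifferentiableAt ℝ f x)
    (hL : ∀ x ∈ Metric.closedBall z r, ‖gradient f x - gradient f z‖ ≤ L * r) (a : E) :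
    |∫ v, (f (z + r • v) - f z) / (r / Module.finrank ℝ E) * ⟪a, v⟫_ℝ ∂μ - ⟪gradient f z, a⟫_ℝ|
      ≤ 2 * L * r * ‖a‖ := by
  have := hμ.isProbabilityMeasure
  set d : ℝ := ((Module.finrank ℝ E : ℕ) : ℝ) with hdim
  -- The second summand integrates exactly to ⟪∇f(z), a⟫ by the covariance formula, so only the
  -- remainder contributes to the bias.
  have heq : ∀ v, (f (z + r • v) - f z) / (r / d) * ⟪a, v⟫_ℝ
      = d / r * (⟪a, v⟫_ℝ * taylorRemainder f z r v)
        + d * (⟪a, v⟫_ℝ * ⟪gradient f z, v⟫_ℝ) := by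
    intro v
    rw [taylorRemainder, div_div_eq_mul_div]
    field_simp
    ring
  have hi1 : Integrable (fun v => ⟪a, v⟫_ℝ * taylorRemainder f z r v) μ := by
    refine integrable_of_bound_on_sphere hμ (C := ‖a‖ * (L * r ^ 2))
      ((innerSL ℝ a).continuous.aestronglyMeasurable.mul
        (aestronglyMeasurable_taylorRemainder hμ hr.le hd)) fun v hv => ?_
    have h3 := abs_real_inner_le_norm a v
    rw [hv, mul_one] at h3
    rw [abs_mul]
    exact mul_le_mul h3 (abs_taylorRemainder_le hr.le hL0 hd hL hv.le) (abs_nonneg _)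
      (norm_nonneg _)
  have hi2 : Integrable (fun v => ⟪a, v⟫_ℝ * ⟪gradient f z, v⟫_ℝ) μ := by
    refine integrable_of_bound_on_sphere hμ (C := ‖a‖ * ‖gradient f z‖)
      (by fun_prop) fun v hv => ?_
    have h1 := abs_real_inner_le_norm a v
    have h2 := abs_real_inner_le_norm (gradient f z) v
    rw [hv, mul_one] at h1 h2
    rw [abs_mul]
    exact mul_le_mul h1 h2 (abs_nonneg _) (norm_nonneg _)
  simp_rw [heq]
  rw [integral_add (hi1.const_mul _) (hi2.const_mul _), integral_const_mul, integral_const_mul,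
    integral_inner_mul_inner hμ, real_inner_comm, add_sub_cancel_right]
  have h := abs_integral_inner_mul_taylorRemainder_le hμ hr.le hL0 hd hL a
  rw [← hdim] at h
  rw [div_mul_eq_mul_div, abs_div, abs_of_pos hr, div_le_iff₀ hr]
  calc _ ≤ _ := h
    _ = _ := by ring

/-- The second moment of the two-point estimator of the gradient. -/
theorem integral_two_point_sq_le (hμ : IsRotationInvariantOnSphere μ)
    (hr : 0 < r) (hL0 : 0 ≤ L) {G : ℝ} (hG : ‖gradient f z‖ ≤ G)
    (hd : ∀ x ∈ Metric.closedBall z r, DifferentiableAt ℝ f x)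
    (hL : ∀ x ∈ Metric.closedBall z r, ‖gradient f x - gradient f z‖ ≤ L * r) :
    ∫ v, ((f (z + r • v) - f z) / (r / Module.finrank ℝ E)) ^ 2 ∂μ
      ≤ 2 * Module.finrank ℝ E * G ^ 2 + 2 * (Module.finrank ℝ E : ℝ) ^ 2 * L ^ 2 * r ^ 2 := by
  have := hμ.isProbabilityMeasure
  have hcov := integral_inner_mul_inner hμ (gradient f z) (gradient f z)
  set d : ℝ := ((Module.finrank ℝ E : ℕ) : ℝ) with hdim
  have hi : Integrable (fun v => 2 * d * (d * (⟪gradient f z, v⟫_ℝ * ⟪gradient f z, v⟫_ℝ))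
      + 2 * d ^ 2 * L ^ 2 * r ^ 2) μ := by
    refine Integrable.add (Integrable.const_mul (Integrable.const_mul ?_ _) _)
      (integrable_const _)
    refine integrable_of_bound_on_sphere hμ (C := ‖gradient f z‖ * ‖gradient f z‖)
      (by fun_prop) fun v hv => ?_
    have h2 := abs_real_inner_le_norm (gradient f z) v
    rw [hv, mul_one] at h2
    rw [abs_mul]
    exact mul_le_mul h2 h2 (abs_nonneg _) (norm_nonneg _)
  calc _ ≤ ∫ v, 2 * d * (d * (⟪gradient f z, v⟫_ℝ * ⟪gradient f z, v⟫_ℝ))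
      + 2 * d ^ 2 * L ^ 2 * r ^ 2 ∂μ := by
        refine integral_mono_of_nonneg (Filter.Eventually.of_forall fun v => sq_nonneg _) hi ?_
        filter_upwards [hμ.norm_eq_one] with v hv
        -- The linear part has mean square d‖∇f(z)‖², one factor d less than its supremum; the
        -- remainder is bounded pointwise. The factors 2 come from (s + t)² ≤ 2s² + 2t².
        have h1 : (f (z + r • v) - f z) / (r / d)
            = d * ⟪gradient f z, v⟫_ℝ + d / r * taylorRemainder f z r v := by
          rw [taylorRemainder, div_div_eq_mul_div]
          field_simp
          ring
        have h2 : (d / r * taylorRemainder f z r v) ^ 2 ≤ d ^ 2 * L ^ 2 * r ^ 2 := by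
          have h3 : taylorRemainder f z r v ^ 2 ≤ (L * r ^ 2) ^ 2 :=
            sq_le_sq' (neg_le_of_abs_le (abs_taylorRemainder_le hr.le hL0 hd hL hv.le))
              (le_of_abs_le (abs_taylorRemainder_le hr.le hL0 hd hL hv.le))
          calc _ = (d / r) ^ 2 * taylorRemainder f z r v ^ 2 := by ring
            _ ≤ (d / r) ^ 2 * (L * r ^ 2) ^ 2 := by gcongr
            _ = _ := by field_simp
        rw [h1]
        nlinarith [sq_nonneg (d * ⟪gradient f z, v⟫_ℝ - d / r * taylorRemainder f z r v)]
    _ = 2 * d * ‖gradient f z‖ ^ 2 + 2 * d ^ 2 * L ^ 2 * r ^ 2 := by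
        rw [integral_add ((hi.sub (integrable_const (2 * d ^ 2 * L ^ 2 * r ^ 2))).congr
          (Filter.Eventually.of_forall fun v => by simp)) (integrable_const _),
          integral_const_mul, integral_const_mul, hcov]
        simp
    _ ≤ _ := by gcongr

end Estimator

/-! ### Projection, extra-gradient inequality and linearization of the gap -/

section PrimalDual

variable {dx dy : ℕ}

theorem finrank_PD : Module.finrank ℝ (PD dx dy) = dx + dy := by
  rw [(WithLp.linearEquiv 2 ℝ (Vec dx × Vec dy)).finrank_eq]
  simp

/-- The reflection `(x, y) ↦ (x, -y)`. -/
def reflectDual (v : PD dx dy) : PD dx dy := mk v.fst (-v.snd)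

/-- Self-adjointness moves the sign flip of the estimator from the random direction onto z - u. -/
theorem inner_reflectDual (v w : PD dx dy) :
    ⟪reflectDual v, w⟫_ℝ = ⟪reflectDual w, v⟫_ℝ := by
  simp [reflectDual, mk, WithLp.prod_inner_apply, real_inner_comm]

theorem norm_reflectDual (v : PD dx dy) : ‖reflectDual v‖ = ‖v‖ := by
  simp [reflectDual, mk, WithLp.prod_norm_eq_of_L2]

theorem continuous_reflectDual : Continuous (reflectDual : PD dx dy → PD dx dy) := by
  unfold reflectDual mk
  exact (WithLp.prod_continuous_toLp 2 _ _).comp (by fun_prop)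

theorem estimator_eq (r : ℝ) (v : PD dx dy) (a b : ℝ) :
    estimator r v a b = ((a - b) / (r / ((dx + dy : ℕ) : ℝ))) • reflectDual v := rfl

section Projection

variable {Z : Set (PD dx dy)}

theorem proj_spec (hne : Z.Nonempty) (hcl : IsClosed Z) (hcv : Convex ℝ Z) (z : PD dx dy) :
    proj Z z ∈ Z ∧ ∀ q ∈ Z, ⟪z - proj Z z, q - proj Z z⟫_ℝ ≤ 0 := by
  have hex : ∃ p, p ∈ Z ∧ ∀ q ∈ Z, ‖z - p‖ ≤ ‖z - q‖ := by
    obtain ⟨p, hp, h⟩ := exists_norm_eq_iInf_of_complete_convex hne hcl.isComplete hcv z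
    refine ⟨p, hp, fun q hq => ?_⟩
    rw [h]
    exact ciInf_le ⟨0, Set.forall_mem_range.2 fun _ => norm_nonneg _⟩ (⟨q, hq⟩ : Z)
  have h := Classical.epsilon_spec hex
  change proj Z z ∈ Z ∧ ∀ q ∈ Z, ‖z - proj Z z‖ ≤ ‖z - q‖ at h
  refine ⟨h.1, (norm_eq_iInf_iff_real_inner_le_zero hcv h.1).1 ?_⟩
  have : Nonempty Z := hne.to_subtype
  exact le_antisymm (le_ciInf fun q => h.2 q q.2)
    (ciInf_le ⟨0, Set.forall_mem_range.2 fun _ => norm_nonneg _⟩ (⟨_, h.1⟩ : Z))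

theorem norm_proj_sub_le (hne : Z.Nonempty) (hcl : IsClosed Z) (hcv : Convex ℝ Z)
    (z w : PD dx dy) : ‖proj Z z - proj Z w‖ ≤ ‖z - w‖ := by
  obtain ⟨hz, hz'⟩ := proj_spec hne hcl hcv z
  obtain ⟨hw, hw'⟩ := proj_spec hne hcl hcv w
  have h1 := hz' _ hw
  have h2 := hw' _ hz
  have h3 : ⟪z - w, proj Z z - proj Z w⟫_ℝ
      = ‖proj Z z - proj Z w‖ ^ 2 - ⟪z - proj Z z, proj Z w - proj Z z⟫_ℝ
        - ⟪w - proj Z w, proj Z z - proj Z w⟫_ℝ := by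
    rw [← real_inner_self_eq_norm_sq]
    simp only [inner_sub_left, inner_sub_right]
    ring
  have h4 := real_inner_le_norm (z - w) (proj Z z - proj Z w)
  by_contra! h
  nlinarith [norm_nonneg (z - w)]

theorem continuous_proj (hne : Z.Nonempty) (hcl : IsClosed Z) (hcv : Convex ℝ Z) :
    Continuous (proj Z) :=
  (LipschitzWith.of_dist_le_mul (K := 1) fun z w => by
    simpa [dist_eq_norm] using norm_proj_sub_le hne hcl hcv z w).continuous

/-- The one-step inequality of the extra-gradient method. -/
theorem extragradient_inequality (hne : Z.Nonempty) (hcl : IsClosed Z) (hcv : Convex ℝ Z)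
    (z a b : PD dx dy) {u : PD dx dy} (hu : u ∈ Z) :
    ⟪b, proj Z (z - a) - u⟫_ℝ
      ≤ ‖z - u‖ ^ 2 / 2 - ‖proj Z (z - b) - u‖ ^ 2 / 2 + ‖b - a‖ ^ 2 / 2 := by
  have h1 := (proj_spec hne hcl hcv (z - b)).2 u hu
  have h2 := (proj_spec hne hcl hcv (z - a)).2 _ (proj_spec hne hcl hcv (z - b)).1
  generalize proj Z (z - a) = p at *
  generalize proj Z (z - b) = q at *
  -- In terms of the displacements s = p - q, t = q - u and w = z - p, the claim is a linear
  -- combination of the two variational inequalities, ‖b - a - s‖² ≥ 0 and ‖w‖² ≥ 0.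
  obtain ⟨s, rfl⟩ : ∃ s, p = q + s := ⟨p - q, by simp⟩
  obtain ⟨t, rfl⟩ : ∃ t, q = u + t := ⟨q - u, by simp⟩
  obtain ⟨w, rfl⟩ : ∃ w, z = u + t + s + w := ⟨z - (u + t + s), by simp⟩
  rw [show u + t + s + w - b - (u + t) = s + w - b by abel, show u - (u + t) = -t by abel] at h1
  rw [show u + t + s + w - a - (u + t + s) = w - a by abel,
    show u + t - (u + t + s) = -s by abel] at h2
  rw [show u + t + s - u = t + s by abel, show u + t + s + w - u = t + s + w by abel,
    show u + t - u = t by abel]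
  have h3 : 0 ≤ ‖b - a - s‖ ^ 2 := sq_nonneg _
  have h4 : 0 ≤ ‖w‖ ^ 2 := sq_nonneg _
  simp only [← real_inner_self_eq_norm_sq, inner_sub_left, inner_sub_right, inner_add_left,
    inner_add_right, inner_neg_right] at *
  rw [real_inner_comm t s, real_inner_comm t w, real_inner_comm s w, real_inner_comm b a,
    real_inner_comm b s, real_inner_comm a s] at *
  linarith

end Projection

/-- A one-sided bound of a directional derivative by a chord. -/
theorem inner_gradient_le_of_chord {E : Type*} [NormedAddCommGroup E] [InnerProductSpace ℝ E]
    [CompleteSpace E] {F : E → ℝ} {z h : E} {c : ℝ} (hF : DifferentiableAt ℝ F z)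
    (hc : ∀ t ∈ Set.Ioo (0 : ℝ) 1, F (z + t • h) - F z ≤ t * c) :
    ⟪gradient F z, h⟫_ℝ ≤ c := by
  have h1 : HasDerivAt (fun t : ℝ => z + t • h) h 0 := by
    simpa using ((hasDerivAt_id (0 : ℝ)).smul_const h).const_add z
  have h2 : HasDerivAt (fun t : ℝ => F (z + t • h)) ⟪gradient F z, h⟫_ℝ 0 := by
    have h3 : HasFDerivAt F (InnerProductSpace.toDual ℝ E (gradient F z)) (z + (0 : ℝ) • h) := by
      simpa using hF.hasGradientAt.hasFDerivAt
    exact h3.comp_hasDerivAt (0 : ℝ) h1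
  have h4 := h2.tendsto_slope_zero_right
  refine le_of_tendsto h4 ?_
  filter_upwards [Ioo_mem_nhdsGT (zero_lt_one : (0 : ℝ) < 1)] with t ht
  have h5 := hc t ht
  simp only [zero_add, zero_smul, add_zero, smul_eq_mul]
  rw [inv_mul_le_iff₀ ht.1]
  exact h5

theorem lagrangian_mk (φ₀ : Vec dx → ℝ) (φ : Fin dy → Vec dx → ℝ) (x : Vec dx) (y : Vec dy) :
    lagrangian φ₀ φ (mk x y) = φ₀ x + ∑ j, y j * φ j x := rfl

/-- The gap of the Lagrangian is bounded by its linearization. -/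
theorem lagrangian_gap_le (φ₀ : Vec dx → ℝ) (φ : Fin dy → Vec dx → ℝ) {X : Set (Vec dx)}
    {z u : PD dx dy} (hz : z.fst ∈ X) (hu : u.fst ∈ X)
    (hconv : ConvexOn ℝ X fun x => lagrangian φ₀ φ (mk x z.snd))
    (hd : DifferentiableAt ℝ (lagrangian φ₀ φ) z) :
    lagrangian φ₀ φ (mk z.fst u.snd) - lagrangian φ₀ φ (mk u.fst z.snd)
      ≤ ⟪gradient (lagrangian φ₀ φ) z, reflectDual (z - u)⟫_ℝ := by
  set f := lagrangian φ₀ φ with hf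
  have hz' : z = mk z.fst z.snd := rfl
  have h1 : ⟪gradient f z, mk (u.fst - z.fst) 0⟫_ℝ ≤ f (mk u.fst z.snd) - f z := by
    refine inner_gradient_le_of_chord hd fun t ht => ?_
    have h2 := hconv.2 hz hu (sub_nonneg.2 ht.2.le) ht.1.le (sub_add_cancel 1 t)
    have h3 : z + t • mk (u.fst - z.fst) 0 = mk ((1 - t) • z.fst + t • u.fst) z.snd := by
      apply (WithLp.equiv 2 _).injective
      ext1
      · simp [mk]; module
      · simp [mk]
    rw [h3]
    simp only [smul_eq_mul] at h2
    rw [← hz'] at h2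
    linarith
  -- As f is affine in y, the chord bound is an equality, even though the point moves away from u
  -- and may leave Y.
  have h2 : ⟪gradient f z, mk 0 (z.snd - u.snd)⟫_ℝ ≤ f z - f (mk z.fst u.snd) := by
    refine inner_gradient_le_of_chord hd fun t _ => ?_
    have h3 : z + t • mk 0 (z.snd - u.snd) = mk z.fst (z.snd + t • (z.snd - u.snd)) := by
      apply (WithLp.equiv 2 _).injective
      ext1 <;> simp [mk]
    rw [h3]
    change f (mk z.fst (z.snd + t • (z.snd - u.snd))) - f (mk z.fst z.snd)
      ≤ t * (f (mk z.fst z.snd) - f (mk z.fst u.snd))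
    simp only [hf, lagrangian_mk, PiLp.add_apply, PiLp.smul_apply, PiLp.sub_apply, smul_eq_mul]
    refine le_of_eq ?_
    simp only [add_mul, sub_mul, mul_assoc, Finset.sum_add_distrib, Finset.sum_sub_distrib,
      ← Finset.mul_sum]
    ring
  have h3 : reflectDual (z - u) = -(mk (u.fst - z.fst) 0 + mk 0 (z.snd - u.snd)) := by
    apply (WithLp.equiv 2 _).injective
    ext1 <;> simp [mk, reflectDual]
  rw [h3, inner_neg_right, inner_add_right]
  linarith

end PrimalDual

/-! ### The run of the algorithm as a recursion -/

section Run

variable {dx dy : ℕ}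

theorem OracleProg.result_bind {E α β : Type} (f : E → ℝ) (p : OracleProg E α)
    (k : α → OracleProg E β) : (p.bind k).result f = (k (p.result f)).result f := by
  induction p with
  | ret a => rfl
  | query z c ih => exact ih (f z)

theorem OracleProg.queries_bind {E α β : Type} (f : E → ℝ) (p : OracleProg E α)
    (k : α → OracleProg E β) :
    (p.bind k).queries f = p.queries f + (k (p.result f)).queries f := by
  induction p with
  | ret a => simp [OracleProg.bind, OracleProg.queries, OracleProg.result]
  | query z c ih =>
    have := ih (f z)
    simp only [OracleProg.bind, OracleProg.queries, OracleProg.result]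
    omega

/-- The two-point estimator at `z` in direction `v`. -/
def gradEst (f : PD dx dy → ℝ) (r : ℝ) (z v : PD dx dy) : PD dx dy :=
  estimator r v (f (z + r • v)) (f z)

/-- The extrapolated point `z_k⁺`. -/
def extrapolate (f : PD dx dy → ℝ) (Z : Set (PD dx dy)) (η r : ℝ)
    (z v : PD dx dy) : PD dx dy :=
  proj Z (z - η • gradEst f r z v)

/-- The next iterate `z_{k+1}`. -/
def update (f : PD dx dy → ℝ) (Z : Set (PD dx dy)) (η r : ℝ)
    (z v w : PD dx dy) : PD dx dy :=
  proj Z (z - η • gradEst f r (extrapolate f Z η r z v) w)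

/-- The iterates `z_k`. -/
def iterate (f : PD dx dy → ℝ) (Z : Set (PD dx dy)) (η : ℝ) (r : ℕ → ℝ)
    (z₀ : PD dx dy) (v w : ℕ → PD dx dy) : ℕ → PD dx dy
  | 0 => z₀
  | k + 1 => update f Z η (r k) (iterate f Z η r z₀ v w k) (v k) (w k)

variable (f : PD dx dy → ℝ) (Z : Set (PD dx dy)) (η : ℝ) (r : ℕ → ℝ) (z₀ : PD dx dy)
  (v w : ℕ → PD dx dy)

/-- The extrapolated iterates `z_k⁺`. -/
def iteratePlus (k : ℕ) : PD dx dy :=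
  extrapolate f Z η (r k) (iterate f Z η r z₀ v w k) (v k)

theorem result_loop (k : ℕ) : (loop Z η r z₀ v w k).result f
    = (iterate f Z η r z₀ v w k, ∑ i ∈ Finset.range k, iteratePlus f Z η r z₀ v w i) := by
  induction k with
  | zero => rfl
  | succ k ih =>
    rw [loop, OracleProg.result_bind, OracleProg.result_bind, ih, Finset.sum_range_succ]
    rfl

theorem queries_loop (k : ℕ) : (loop Z η r z₀ v w k).queries f = 4 * k := by
  induction k with
  | zero => rfl
  | succ k ih =>
    rw [loop, OracleProg.queries_bind, OracleProg.queries_bind, ih]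
    simp only [step, OracleProg.queries]
    ring

theorem result_zoeg (K : ℕ) : (zoeg Z η r z₀ v w K).result f
    = (K : ℝ)⁻¹ • ∑ i ∈ Finset.range K, iteratePlus f Z η r z₀ v w i := by
  rw [zoeg, OracleProg.result_bind, result_loop]
  rfl

theorem queries_zoeg (K : ℕ) : (zoeg Z η r z₀ v w K).queries f = 4 * K := by
  rw [zoeg, OracleProg.queries_bind, queries_loop]
  rfl

variable {f Z η r z₀ v w}

theorem extrapolate_mem (hne : Z.Nonempty) (hcl : IsClosed Z) (hcv : Convex ℝ Z) {r : ℝ}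
    (z v : PD dx dy) : extrapolate f Z η r z v ∈ Z :=
  (proj_spec hne hcl hcv _).1

theorem iterate_mem (hne : Z.Nonempty) (hcl : IsClosed Z) (hcv : Convex ℝ Z) (hz₀ : z₀ ∈ Z)
    (k : ℕ) : iterate f Z η r z₀ v w k ∈ Z := by
  cases k with
  | zero => exact hz₀
  | succ k => exact (proj_spec hne hcl hcv _).1

/-- All queries are made in `Z` or at distance `r k` from it along a unit vector, so the run cannot
distinguish f from an extension that agrees with it there. -/
theorem iterate_congr {h : PD dx dy → ℝ} (hne : Z.Nonempty) (hcl : IsClosed Z)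
    (hcv : Convex ℝ Z) (hz₀ : z₀ ∈ Z) (hfh : ∀ z ∈ Z, f z = h z)
    (hfhr : ∀ z ∈ Z, ∀ k v, ‖v‖ = 1 → f (z + r k • v) = h (z + r k • v))
    (hv : ∀ k, ‖v k‖ = 1) (hw : ∀ k, ‖w k‖ = 1) (k : ℕ) :
    iterate f Z η r z₀ v w k = iterate h Z η r z₀ v w k ∧
      iteratePlus f Z η r z₀ v w k = iteratePlus h Z η r z₀ v w k := by
  have hest : ∀ z ∈ Z, ∀ k v, ‖v‖ = 1 → gradEst f (r k) z v = gradEst h (r k) z v := by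
    intro z hz k v hv
    rw [gradEst, gradEst, hfh z hz, hfhr z hz k v hv]
  have hplus : ∀ k, iterate f Z η r z₀ v w k = iterate h Z η r z₀ v w k →
      iteratePlus f Z η r z₀ v w k = iteratePlus h Z η r z₀ v w k := by
    intro k hk
    rw [iteratePlus, iteratePlus, extrapolate, extrapolate, hk,
      hest _ (iterate_mem hne hcl hcv hz₀ k) k _ (hv k)]
  induction k with
  | zero => exact ⟨rfl, hplus 0 rfl⟩
  | succ k ih =>
    have h1 : iterate f Z η r z₀ v w (k + 1) = iterate h Z η r z₀ v w (k + 1) := by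
      have h2 := ih.2
      simp only [iteratePlus] at h2
      rw [iterate, iterate, update, update, h2, ih.1,
        hest _ (extrapolate_mem hne hcl hcv _ _) k _ (hw k)]
    exact ⟨h1, hplus _ h1⟩

theorem continuous_gradEst {A : Type*} [TopologicalSpace A] {a b : A → PD dx dy}
    (hf : Continuous f) (r : ℝ) (ha : Continuous a) (hb : Continuous b) :
    Continuous fun t => gradEst f r (a t) (b t) := by
  simp only [gradEst, estimator_eq]
  have h1 : Continuous fun t => f (a t + r • b t) := hf.comp (ha.add (hb.const_smul r))
  have h2 : Continuous fun t => f (a t) := hf.comp ha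
  have h3 : Continuous fun t => reflectDual (b t) := continuous_reflectDual.comp hb
  exact ((h1.sub h2).div_const (r / ((dx + dy : ℕ) : ℝ))).smul h3

theorem continuous_extrapolate {A : Type*} [TopologicalSpace A] {a b : A → PD dx dy}
    (hne : Z.Nonempty) (hcl : IsClosed Z) (hcv : Convex ℝ Z) (hf : Continuous f) (r : ℝ)
    (ha : Continuous a) (hb : Continuous b) :
    Continuous fun t => extrapolate f Z η r (a t) (b t) := by
  have h1 : Continuous fun t => a t - η • gradEst f r (a t) (b t) :=
    ha.sub ((continuous_gradEst hf r ha hb).const_smul η)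
  exact (continuous_proj hne hcl hcv).comp h1

theorem continuous_update {A : Type*} [TopologicalSpace A] {a b c : A → PD dx dy}
    (hne : Z.Nonempty) (hcl : IsClosed Z) (hcv : Convex ℝ Z) (hf : Continuous f) (r : ℝ)
    (ha : Continuous a) (hb : Continuous b) (hc : Continuous c) :
    Continuous fun t => update f Z η r (a t) (b t) (c t) := by
  have h1 : Continuous fun t =>
      a t - η • gradEst f r (extrapolate f Z η r (a t) (b t)) (c t) :=
    ha.sub ((continuous_gradEst hf r
      (continuous_extrapolate hne hcl hcv hf r ha hb) hc).const_smul η)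
  exact (continuous_proj hne hcl hcv).comp h1

theorem measurable_iterate {Ω : Type*} {m : MeasurableSpace Ω} {v w : ℕ → Ω → PD dx dy}
    (hne : Z.Nonempty) (hcl : IsClosed Z) (hcv : Convex ℝ Z) (hf : Continuous f) (k : ℕ)
    (hv : ∀ i < k, Measurable (v i)) (hw : ∀ i < k, Measurable (w i)) :
    Measurable fun ω => iterate f Z η r z₀ (fun i => v i ω) (fun i => w i ω) k := by
  induction k with
  | zero => exact measurable_const
  | succ k ih =>
    have h1 := ih (fun i hi => hv i (by omega)) (fun i hi => hw i (by omega))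
    have h2 : Measurable fun p : PD dx dy × PD dx dy × PD dx dy =>
        update f Z η (r k) p.1 p.2.1 p.2.2 :=
      (continuous_update hne hcl hcv hf (r k) continuous_fst
        (continuous_fst.comp continuous_snd) (continuous_snd.comp continuous_snd)).measurable
    have h3 := h1.prodMk ((hv k (by omega)).prodMk (hw k (by omega)))
    have h4 := h2.comp h3
    simp only [Function.comp_def] at h4
    simp only [iterate]
    exact h4

theorem measurable_iteratePlus {Ω : Type*} {m : MeasurableSpace Ω} {v w : ℕ → Ω → PD dx dy}
    (hne : Z.Nonempty) (hcl : IsClosed Z) (hcv : Convex ℝ Z) (hf : Continuous f) (k : ℕ)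
    (hv : ∀ i ≤ k, Measurable (v i)) (hw : ∀ i < k, Measurable (w i)) :
    Measurable fun ω => iteratePlus f Z η r z₀ (fun i => v i ω) (fun i => w i ω) k := by
  have h1 : Measurable fun ω => iterate f Z η r z₀ (fun i => v i ω) (fun i => w i ω) k :=
    measurable_iterate hne hcl hcv hf k (fun i hi => hv i hi.le) hw
  have h2 : Measurable fun p : PD dx dy × PD dx dy => extrapolate f Z η (r k) p.1 p.2 :=
    (continuous_extrapolate hne hcl hcv hf (r k) continuous_fst continuous_snd).measurable
  have h3 := h1.prodMk (hv k le_rfl)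
  have h4 := h2.comp h3
  simp only [Function.comp_def] at h4
  simp only [iteratePlus]
  exact h4

end Run

/-! ### Independence and conditioning on the past -/

section Probability

variable {dx dy : ℕ} {Ω : Type*} {mΩ : MeasurableSpace Ω} {P : Measure Ω}

/-- Gives independence of the current iterate, a function of earlier perturbations, from the fresh
one. -/
theorem indepFun_of_measurable_iSup {ι β : Type*} {mβ : MeasurableSpace β} {ξ : ι → Ω → β}
    (hξ : ∀ i, Measurable (ξ i)) (hind : iIndepFun ξ P) {S : Set ι} {i : ι} (hi : i ∉ S)
    {γ : Type*} {mγ : MeasurableSpace γ} {X : Ω → γ}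
    (hX : Measurable[⨆ j ∈ S, mβ.comap (ξ j)] X) : IndepFun X (ξ i) P := by
  rw [IndepFun_iff_Indep]
  have h1 := indep_iSup_of_disjoint (fun j => (hξ j).comap_le) hind
    (Set.disjoint_singleton_right.2 hi)
  refine indep_of_indep_of_le_left (indep_of_indep_of_le_right h1 ?_) hX.comap_le
  simp

theorem integrable_of_mem_compact [IsFiniteMeasure P] {E : Type*} [TopologicalSpace E]
    [MeasurableSpace E] [BorelSpace E] {X : Ω → E} (hX : Measurable X) {S : Set E}
    (hS : IsCompact S) (hXS : ∀ ω, X ω ∈ S) {ψ : E → ℝ} (hψ : Continuous ψ) :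
    Integrable (fun ω => ψ (X ω)) P := by
  obtain ⟨B, hB⟩ := hS.exists_bound_of_continuousOn hψ.continuousOn
  exact Integrable.of_bound (hψ.measurable.comp hX).aestronglyMeasurable B
    (Filter.Eventually.of_forall fun ω => hB _ (hXS ω))

/-- An average over an independent perturbation is controlled by the partial averages. -/
theorem integral_le_of_indepFun [IsProbabilityMeasure P] {Z : Set (PD dx dy)}
    (hZ : IsCompact Z) {X W : Ω → PD dx dy} (hX : Measurable X) (hW : Measurable W)
    (hXZ : ∀ ω, X ω ∈ Z) (hW1 : ∀ ω, ‖W ω‖ = 1) (hind : IndepFun X W P)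
    {μ : Measure (PD dx dy)} (hlaw : P.map W = μ) {ψ : PD dx dy × PD dx dy → ℝ}
    (hψ : Continuous ψ) {c : ℝ} (hc : ∀ z ∈ Z, ∫ v, ψ (z, v) ∂μ ≤ c) :
    ∫ ω, ψ (X ω, W ω) ∂P ≤ c := by
  -- The joint law is a product, so Fubini plays the role of conditioning on `X`.
  have hprod := (indepFun_iff_map_prod_eq_prod_map_map hX.aemeasurable hW.aemeasurable).1 hind
  have hint : Integrable (fun ω => ψ (X ω, W ω)) P :=
    integrable_of_mem_compact (hX.prodMk hW) (hZ.prod (isCompact_sphere (0 : PD dx dy) 1))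
      (fun ω => ⟨hXZ ω, by simpa using hW1 ω⟩) hψ
  have : IsProbabilityMeasure (P.map X) := Measure.isProbabilityMeasure_map hX.aemeasurable
  have : IsProbabilityMeasure (P.map W) := Measure.isProbabilityMeasure_map hW.aemeasurable
  have hint' : Integrable ψ ((P.map X).prod (P.map W)) := by
    rw [← hprod]
    exact (integrable_map_measure hψ.aestronglyMeasurable (hX.prodMk hW).aemeasurable).2 hint
  have h1 : ∫ ω, ψ (X ω, W ω) ∂P = ∫ z, ∫ v, ψ (z, v) ∂(P.map W) ∂(P.map X) := by
    rw [← integral_prod _ hint', ← hprod,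
      integral_map (hX.prodMk hW).aemeasurable hψ.aestronglyMeasurable]
  rw [h1, hlaw]
  have h2 : ∀ᵐ z ∂(P.map X), z ∈ Z := by
    rw [ae_map_iff (p := fun z => z ∈ Z) hX.aemeasurable hZ.measurableSet]
    exact Filter.Eventually.of_forall hXZ
  have hi := hint'.integral_prod_left
  rw [hlaw] at hi
  calc _ ≤ ∫ _, c ∂(P.map X) := by
        refine integral_mono_ae hi (integrable_const c) ?_
        filter_upwards [h2] with z hz using hc z hz
    _ = c := by simp

/-- A random unit vector agrees almost surely with a measurable one that always has norm one. -/
theorem exists_unit_modification [IsProbabilityMeasure P] {μ : Measure (PD dx dy)}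
    (hμ : IsRotationInvariantOnSphere μ) {v : Ω → PD dx dy} (hv : HasLaw v μ P) :
    ∃ v' : Ω → PD dx dy, Measurable v' ∧ (∀ ω, ‖v' ω‖ = 1) ∧ v =ᵐ[P] v' := by
  have := hμ.isProbabilityMeasure
  obtain ⟨e, he⟩ := hμ.norm_eq_one.exists
  classical
  -- Off the unit sphere, a null set for the law, the value is replaced by a fixed unit vector.
  let g : PD dx dy → PD dx dy := fun x => if ‖x‖ = 1 then x else e
  have hg : Measurable g :=
    Measurable.ite (measurableSet_eq_fun measurable_norm measurable_const) measurable_id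
      measurable_const
  refine ⟨fun ω => g (hv.aemeasurable.mk v ω), hg.comp hv.aemeasurable.measurable_mk, ?_, ?_⟩
  · intro ω
    simp only [g]
    split_ifs with h
    exacts [h, he]
  · have h1 : ∀ᵐ ω ∂P, ‖v ω‖ = 1 := by
      have h2 := hμ.norm_eq_one
      rw [← hv.map_eq] at h2
      exact ae_of_ae_map hv.aemeasurable h2
    filter_upwards [h1, hv.aemeasurable.ae_eq_mk] with ω h2 h3
    simp only [g]
    rw [← h3, if_pos h2]

end Probability

/-! ### Expected progress of one iteration -/

section Gap

variable {dx dy : ℕ}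

/-- The gap `f(x, u_y) - f(u_x, y)` of `z = (x, y)` relative to the comparison point `u`. -/
def gap (f : PD dx dy → ℝ) (u z : PD dx dy) : ℝ := f (mk z.fst u.snd) - f (mk u.fst z.snd)

theorem continuous_mk : Continuous fun p : Vec dx × Vec dy => mk p.1 p.2 :=
  WithLp.prod_continuous_toLp 2 _ _

theorem continuous_fst_PD : Continuous fun z : PD dx dy => z.fst :=
  continuous_fst.comp (WithLp.prod_continuous_ofLp 2 _ _)

theorem continuous_snd_PD : Continuous fun z : PD dx dy => z.snd :=
  continuous_snd.comp (WithLp.prod_continuous_ofLp 2 _ _)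

theorem continuous_gap {f : PD dx dy → ℝ} (hf : Continuous f) (u : PD dx dy) :
    Continuous (gap f u) := by
  have h1 : Continuous fun z : PD dx dy => mk z.fst u.snd :=
    continuous_mk.comp (continuous_fst_PD.prodMk continuous_const)
  have h2 : Continuous fun z : PD dx dy => mk u.fst z.snd :=
    continuous_mk.comp (continuous_const.prodMk continuous_snd_PD)
  exact (hf.comp h1).sub (hf.comp h2)

/-- `f` is differentiable on the `ρ`-neighbourhood of `Z`, its gradient has norm at most `G`
on `Z`, and the gradient varies at rate at most `L` away from `Z`. -/
structure IsRegularNear (f : PD dx dy → ℝ) (Z : Set (PD dx dy)) (G L ρ : ℝ) : Prop where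
  differentiableAt : ∀ z ∈ Z, ∀ x ∈ Metric.closedBall z ρ, DifferentiableAt ℝ f x
  norm_gradient_le : ∀ z ∈ Z, ‖gradient f z‖ ≤ G
  norm_gradient_sub_le : ∀ z ∈ Z, ∀ x ∈ Metric.closedBall z ρ,
    ‖gradient f x - gradient f z‖ ≤ L * ‖x - z‖

variable {f h : PD dx dy → ℝ} {Z : Set (PD dx dy)} {G L ρ r : ℝ} {μ : Measure (PD dx dy)}

theorem IsRegularNear.differentiableAt_closedBall (hf : IsRegularNear f Z G L ρ) (hrρ : r ≤ ρ)
    {z : PD dx dy} (hz : z ∈ Z) : ∀ x ∈ Metric.closedBall z r, DifferentiableAt ℝ f x :=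
  fun x hx => hf.differentiableAt z hz x (Metric.closedBall_subset_closedBall hrρ hx)

theorem IsRegularNear.norm_gradient_sub_le_closedBall (hf : IsRegularNear f Z G L ρ)
    (hL : 0 ≤ L) (hrρ : r ≤ ρ) {z : PD dx dy} (hz : z ∈ Z) :
    ∀ x ∈ Metric.closedBall z r, ‖gradient f x - gradient f z‖ ≤ L * r := by
  intro x hx
  refine (hf.norm_gradient_sub_le z hz x (Metric.closedBall_subset_closedBall hrρ hx)).trans ?_
  have := mem_closedBall_iff_norm.1 hx
  gcongr

theorem integrable_on_sphere_of_continuous (hμ : IsRotationInvariantOnSphere μ)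
    {q : PD dx dy → ℝ} (hq : Continuous q) : Integrable q μ := by
  obtain ⟨B, hB⟩ :=
    (isCompact_sphere (0 : PD dx dy) 1).exists_bound_of_continuousOn hq.continuousOn
  exact integrable_of_bound_on_sphere hμ hq.aestronglyMeasurable
    fun v hv => hB v (by simpa using hv)

/-- The estimator overestimates the gap, up to the smoothing bias. -/
theorem integral_gap_sub_inner_gradEst_le (hμ : IsRotationInvariantOnSphere μ)
    (hf : IsRegularNear f Z G L ρ) (hL : 0 ≤ L) (hr : 0 < r) (hrρ : r ≤ ρ)
    (hh : Continuous h) (hfh : ∀ z ∈ Z, ∀ x ∈ Metric.closedBall z ρ, f x = h x)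
    {z u : PD dx dy} (hz : z ∈ Z)
    (hgap : gap h u z ≤ ⟪gradient f z, reflectDual (z - u)⟫_ℝ) :
    ∫ v, (gap h u z - ⟪gradEst h r z v, z - u⟫_ℝ) ∂μ ≤ 2 * L * r * ‖z - u‖ := by
  have := hμ.isProbabilityMeasure
  have hint : Integrable (fun v => ⟪gradEst h r z v, z - u⟫_ℝ) μ :=
    integrable_on_sphere_of_continuous hμ
      ((continuous_gradEst hh r continuous_const continuous_id).inner continuous_const)
  have h1 : ∫ v, ⟪gradEst h r z v, z - u⟫_ℝ ∂μ
      = ∫ v, (f (z + r • v) - f z) / (r / Module.finrank ℝ (PD dx dy))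
        * ⟪reflectDual (z - u), v⟫_ℝ ∂μ := by
    refine integral_congr_ae ?_
    filter_upwards [hμ.norm_eq_one] with v hv
    have hρ : 0 ≤ ρ := hr.le.trans hrρ
    rw [gradEst, estimator_eq, real_inner_smul_left, inner_reflectDual v, finrank_PD,
      hfh z hz z (Metric.mem_closedBall_self hρ),
      hfh z hz _ (Metric.closedBall_subset_closedBall hrρ (add_smul_mem_closedBall hr.le hv.le))]
  have h2 := abs_integral_two_point_sub_le hμ hr hL (hf.differentiableAt_closedBall hrρ hz)
    (hf.norm_gradient_sub_le_closedBall hL hrρ hz) (reflectDual (z - u))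
  rw [← h1, norm_reflectDual] at h2
  rw [integral_sub (integrable_const _) hint]
  simp only [integral_const, probReal_univ, smul_eq_mul, one_mul]
  linarith [neg_le_of_abs_le h2]

theorem integral_norm_gradEst_sq_le (hμ : IsRotationInvariantOnSphere μ)
    (hf : IsRegularNear f Z G L ρ) (hL : 0 ≤ L) (hr : 0 < r) (hrρ : r ≤ ρ)
    (hfh : ∀ z ∈ Z, ∀ x ∈ Metric.closedBall z ρ, f x = h x)
    {z : PD dx dy} (hz : z ∈ Z) :
    ∫ v, ‖gradEst h r z v‖ ^ 2 ∂μ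
      ≤ 2 * (dx + dy : ℕ) * G ^ 2 + 2 * ((dx + dy : ℕ) : ℝ) ^ 2 * L ^ 2 * r ^ 2 := by
  have h2 := integral_two_point_sq_le hμ hr hL (hf.norm_gradient_le z hz)
    (hf.differentiableAt_closedBall hrρ hz) (hf.norm_gradient_sub_le_closedBall hL hrρ hz)
  rw [finrank_PD] at h2
  refine le_of_eq_of_le ?_ h2
  refine integral_congr_ae ?_
  filter_upwards [hμ.norm_eq_one] with v hv
  have hρ : 0 ≤ ρ := hr.le.trans hrρ
  rw [gradEst, estimator_eq, norm_smul, norm_reflectDual, hv, mul_one, Real.norm_eq_abs, sq_abs,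
    hfh z hz z (Metric.mem_closedBall_self hρ),
    hfh z hz _ (Metric.closedBall_subset_closedBall hrρ (add_smul_mem_closedBall hr.le hv.le))]

variable {Ω : Type*} {mΩ : MeasurableSpace Ω} {P : Measure Ω} [IsProbabilityMeasure P]
  {v w : ℕ → Ω → PD dx dy} {η : ℝ} {r : ℕ → ℝ} {z₀ u : PD dx dy}

/-- The expected progress of one iteration. -/
theorem integral_gap_iteratePlus_le (hZ : IsCompact Z) (hcv : Convex ℝ Z) (hz₀ : z₀ ∈ Z)
    (hu : u ∈ Z) (hh : Continuous h) (hη : 0 ≤ η)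
    (hvm : ∀ k, Measurable (v k)) (hwm : ∀ k, Measurable (w k))
    (hv1 : ∀ k ω, ‖v k ω‖ = 1) (hw1 : ∀ k ω, ‖w k ω‖ = 1)
    (hvlaw : ∀ k, P.map (v k) = μ) (hwlaw : ∀ k, P.map (w k) = μ)
    (hind : iIndepFun (Sum.elim v w) P) (k : ℕ) {β V : ℝ}
    (hβ : ∀ z ∈ Z, ∫ v, (gap h u z - ⟪gradEst h (r k) z v, z - u⟫_ℝ) ∂μ ≤ β)
    (hV : ∀ z ∈ Z, ∫ v, ‖gradEst h (r k) z v‖ ^ 2 ∂μ ≤ V) :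
    η * ∫ ω, gap h u (iteratePlus h Z η r z₀ (fun i => v i ω) (fun i => w i ω) k) ∂P
      ≤ (∫ ω, ‖iterate h Z η r z₀ (fun i => v i ω) (fun i => w i ω) k - u‖ ^ 2 ∂P) / 2
        - (∫ ω, ‖iterate h Z η r z₀ (fun i => v i ω) (fun i => w i ω) (k + 1) - u‖ ^ 2 ∂P) / 2
        + 2 * η ^ 2 * V + η * β := by
  have hne : Z.Nonempty := ⟨_, hz₀⟩
  have hcl := hZ.isClosed
  set X : ℕ → Ω → PD dx dy := fun k ω =>
    iterate h Z η r z₀ (fun i => v i ω) (fun i => w i ω) k with hX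
  set Y : Ω → PD dx dy := fun ω =>
    iteratePlus h Z η r z₀ (fun i => v i ω) (fun i => w i ω) k with hY
  have hXm : ∀ k, Measurable (X k) := fun k =>
    measurable_iterate hne hcl hcv hh k (fun i _ => hvm i) (fun i _ => hwm i)
  have hYm : Measurable Y :=
    measurable_iteratePlus hne hcl hcv hh k (fun i _ => hvm i) (fun i _ => hwm i)
  have hXZ : ∀ k ω, X k ω ∈ Z := fun k ω => iterate_mem hne hcl hcv hz₀ k
  have hYZ : ∀ ω, Y ω ∈ Z := fun ω => extrapolate_mem hne hcl hcv _ _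
  have hξ : ∀ i, Measurable (Sum.elim v w i) := by
    rintro (i | i)
    exacts [hvm i, hwm i]
  have hXind : IndepFun (X k) (v k) P := by
    refine indepFun_of_measurable_iSup hξ hind (i := Sum.inl k)
      (S := {j | Sum.elim (fun i => i < k) (fun i => i < k) j}) (by simp) ?_
    refine measurable_iterate hne hcl hcv hh k (fun i hi => ?_) (fun i hi => ?_)
    · exact (comap_measurable (v i)).mono
        (le_iSup₂_of_le (Sum.inl i) (by simpa using hi) le_rfl) le_rfl
    · exact (comap_measurable (w i)).mono
        (le_iSup₂_of_le (Sum.inr i) (by simpa using hi) le_rfl) le_rfl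
  -- z_k⁺ has already used v_k but not w_k, hence `≤` for the first family and `<` for the second.
  have hYind : IndepFun Y (w k) P := by
    refine indepFun_of_measurable_iSup hξ hind (i := Sum.inr k)
      (S := {j | Sum.elim (fun i => i ≤ k) (fun i => i < k) j}) (by simp) ?_
    refine measurable_iteratePlus hne hcl hcv hh k (fun i hi => ?_) (fun i hi => ?_)
    · exact (comap_measurable (v i)).mono
        (le_iSup₂_of_le (Sum.inl i) (by simpa using hi) le_rfl) le_rfl
    · exact (comap_measurable (w i)).mono
        (le_iSup₂_of_le (Sum.inr i) (by simpa using hi) le_rfl) le_rfl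
  have hgc : Continuous fun p : PD dx dy × PD dx dy => gradEst h (r k) p.1 p.2 :=
    continuous_gradEst hh (r k) continuous_fst continuous_snd
  have hφ : Continuous fun p : PD dx dy × PD dx dy => ‖gradEst h (r k) p.1 p.2‖ ^ 2 :=
    hgc.norm.pow 2
  have hin : Continuous fun p : PD dx dy × PD dx dy =>
      ⟪gradEst h (r k) p.1 p.2, p.1 - u⟫_ℝ := hgc.inner (continuous_fst.sub continuous_const)
  have hψ : Continuous fun p : PD dx dy × PD dx dy =>
      gap h u p.1 - ⟪gradEst h (r k) p.1 p.2, p.1 - u⟫_ℝ :=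
    ((continuous_gap hh u).comp continuous_fst).sub hin
  have hS := hZ.prod (isCompact_sphere (0 : PD dx dy) 1)
  have b1 := integral_le_of_indepFun hZ (hXm k) (hvm k) (hXZ k) (hv1 k) hXind (hvlaw k) hφ hV
  have b2 := integral_le_of_indepFun hZ hYm (hwm k) hYZ (hw1 k) hYind (hwlaw k) hφ hV
  have b3 := integral_le_of_indepFun hZ hYm (hwm k) hYZ (hw1 k) hYind (hwlaw k) hψ hβ
  have hYw : ∀ ω, (Y ω, w k ω) ∈ Z ×ˢ Metric.sphere (0 : PD dx dy) 1 := fun ω =>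
    ⟨hYZ ω, by simpa using hw1 k ω⟩
  have hXv : ∀ ω, (X k ω, v k ω) ∈ Z ×ˢ Metric.sphere (0 : PD dx dy) 1 := fun ω =>
    ⟨hXZ k ω, by simpa using hv1 k ω⟩
  have i1 : Integrable (fun ω => ‖gradEst h (r k) (X k ω) (v k ω)‖ ^ 2) P :=
    integrable_of_mem_compact ((hXm k).prodMk (hvm k)) hS hXv hφ
  have i2 : Integrable (fun ω => ‖gradEst h (r k) (Y ω) (w k ω)‖ ^ 2) P :=
    integrable_of_mem_compact (hYm.prodMk (hwm k)) hS hYw hφ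
  have i3 : Integrable (fun ω => ⟪gradEst h (r k) (Y ω) (w k ω), Y ω - u⟫_ℝ) P :=
    integrable_of_mem_compact (hYm.prodMk (hwm k)) hS hYw hin
  have i4 : Integrable (fun ω => gap h u (Y ω)) P :=
    integrable_of_mem_compact hYm hZ hYZ (continuous_gap hh u)
  have i5 : ∀ k, Integrable (fun ω => ‖X k ω - u‖ ^ 2) P := fun k =>
    integrable_of_mem_compact (hXm k) hZ (hXZ k)
      (ψ := fun z => ‖z - u‖ ^ 2) (by fun_prop)
  simp only at b1 b2 b3
  rw [integral_sub i4 i3] at b3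
  have hpt : ∀ ω, η * ⟪gradEst h (r k) (Y ω) (w k ω), Y ω - u⟫_ℝ
      ≤ ‖X k ω - u‖ ^ 2 / 2 - ‖X (k + 1) ω - u‖ ^ 2 / 2
        + (η ^ 2 * ‖gradEst h (r k) (X k ω) (v k ω)‖ ^ 2
          + η ^ 2 * ‖gradEst h (r k) (Y ω) (w k ω)‖ ^ 2) := by
    intro ω
    have h1 := extragradient_inequality hne hcl hcv (X k ω)
      (η • gradEst h (r k) (X k ω) (v k ω)) (η • gradEst h (r k) (Y ω) (w k ω)) hu
    rw [real_inner_smul_left] at h1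
    refine h1.trans ?_
    -- The two estimators are compared only through their sizes, by the parallelogram law; no
    -- cancellation between them is used.
    have h2 : ‖η • gradEst h (r k) (Y ω) (w k ω) - η • gradEst h (r k) (X k ω) (v k ω)‖ ^ 2
        ≤ 2 * (η ^ 2 * ‖gradEst h (r k) (X k ω) (v k ω)‖ ^ 2
          + η ^ 2 * ‖gradEst h (r k) (Y ω) (w k ω)‖ ^ 2) := by
      have h3 := parallelogram_law_with_norm ℝ (η • gradEst h (r k) (Y ω) (w k ω))
        (η • gradEst h (r k) (X k ω) (v k ω))
      rw [norm_smul, norm_smul, Real.norm_of_nonneg hη] at h3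
      nlinarith [sq_nonneg ‖η • gradEst h (r k) (Y ω) (w k ω)
        + η • gradEst h (r k) (X k ω) (v k ω)‖]
    change ‖X k ω - u‖ ^ 2 / 2 - ‖X (k + 1) ω - u‖ ^ 2 / 2 + _ ≤ _
    linarith
  have hmono := integral_mono (i3.const_mul η)
    ((((i5 k).div_const 2).sub ((i5 (k + 1)).div_const 2)).add
      ((i1.const_mul (η ^ 2)).add (i2.const_mul (η ^ 2)))) hpt
  rw [integral_add' (((i5 k).div_const 2).sub ((i5 (k + 1)).div_const 2))
      ((i1.const_mul (η ^ 2)).add (i2.const_mul (η ^ 2))),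
    integral_sub' ((i5 k).div_const 2) ((i5 (k + 1)).div_const 2),
    integral_add' (i1.const_mul (η ^ 2)) (i2.const_mul (η ^ 2)),
    integral_const_mul, integral_const_mul, integral_const_mul, integral_div, integral_div] at hmono
  have c1 := mul_le_mul_of_nonneg_left b1 (sq_nonneg η)
  have c2 := mul_le_mul_of_nonneg_left b2 (sq_nonneg η)
  have c3 := mul_le_mul_of_nonneg_left b3 hη
  change η * ∫ ω, gap h u (Y ω) ∂P ≤ (∫ ω, ‖X k ω - u‖ ^ 2 ∂P) / 2
    - (∫ ω, ‖X (k + 1) ω - u‖ ^ 2 ∂P) / 2 + 2 * η ^ 2 * V + η * β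
  linarith

end Gap

/-! ### Step size, iteration count and complexity -/

section Arithmetic

/-- Index 0 is kept out of the telescoping because the error `e 0` would involve the radius r_0,
which the sums M₁ and M₂ do not control. -/
theorem sum_range_succ_le_of_telescope {a g e : ℕ → ℝ} (h : ∀ k, g k ≤ a k - a (k + 1) + e k)
    (m : ℕ) : ∑ k ∈ Finset.range (m + 1), g k
      ≤ g 0 + a 1 - a (m + 1) + ∑ k ∈ Finset.range m, e (k + 1) := by
  rw [Finset.sum_range_succ']
  have h1 : ∑ k ∈ Finset.range m, g (k + 1)
      ≤ ∑ k ∈ Finset.range m, (a (k + 1) - a (k + 1 + 1) + e (k + 1)) :=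
    Finset.sum_le_sum fun k _ => h (k + 1)
  rw [Finset.sum_add_distrib, Finset.sum_range_sub' (fun k => a (k + 1)) m] at h1
  simp only [zero_add] at h1
  linarith

theorem le_cube_of_rpow_le {A K : ℝ} (hA : 0 ≤ A) (h : A ^ (1 / 3 : ℝ) ≤ K) : A ≤ K ^ 3 := by
  have h1 : (A ^ (1 / 3 : ℝ)) ^ 3 = A := by
    rw [← Real.rpow_natCast, ← Real.rpow_mul hA]
    norm_num
  rw [← h1]
  exact pow_le_pow_left₀ (Real.rpow_nonneg hA _) h 3

/-- The choice of the step size and of the number of iterations balances all error terms. -/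
theorem stepSize_budget {d K : ℕ} (hd : 1 ≤ d) {G L D M₁ M₂ ε : ℝ} (hG : 0 < G)
    (hε : 0 < ε) (hεD : ε < G * D)
    (hK1 : 1 ≤ K) (hK : iterBound d G L D M₁ M₂ ε ≤ K) :
    0 < stepSize d K G D ∧
      stepSize d K G D * (G * D) + D ^ 2 / 2 + 2 * stepSize d K G D ^ 2
        * (2 * d * G ^ 2 * K + 2 * (d : ℝ) ^ 2 * L ^ 2 * M₂)
        + stepSize d K G D * (2 * L * M₁ * D) ≤ stepSize d K G D * (K * ε) := by
  have hD : 0 < D := pos_of_mul_pos_right (hε.trans hεD) hG.le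
  have hd' : (1 : ℝ) ≤ d := by exact_mod_cast hd
  have hK' : (1 : ℝ) ≤ K := by exact_mod_cast hK1
  rw [iterBound, max_le_iff, max_le_iff] at hK
  obtain ⟨⟨hA, hB⟩, hC⟩ := hK
  rw [div_le_iff₀ (by positivity)] at hA
  rw [div_le_iff₀ hε] at hC
  have hB' := le_cube_of_rpow_le (by positivity) hB
  rw [div_le_iff₀ (by positivity)] at hB'
  set S : ℝ := √(6 * d * K) with hS
  have hS2 : S ^ 2 = 6 * d * K := Real.sq_sqrt (by positivity)
  have hS0 : 0 < S := Real.sqrt_pos.2 (by positivity)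
  set η : ℝ := stepSize d K G D with hη
  have hηS : η * (6 * S * G) = D := by
    rw [hη, stepSize, ← hS]
    field_simp
  have hη0 : 0 < η := by
    rw [hη, stepSize, ← hS]
    positivity
  -- The first lower bound on K gives 864 (GD)² ≤ Kε², and one factor ε is then traded for GD > ε.
  have e1 : G * D ≤ K * ε / 864 := by
    have h1 : 864 * (G * D) ^ 2 ≤ K * ε * (G * D) := by
      calc 864 * (G * D) ^ 2 ≤ 864 * d * G ^ 2 * D ^ 2 := by
            have : 0 ≤ G ^ 2 * D ^ 2 := by positivity
            nlinarith
        _ ≤ K * ε * ε := by linarith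
        _ ≤ K * ε * (G * D) := by gcongr
    have h2 : 0 < G * D := hε.trans hεD
    nlinarith
  -- The same bound in exact form: 12² · 6 = 864.
  have e2 : 12 * S * G * D ≤ K * ε := by
    refine le_of_sq_le_sq ?_ (by positivity)
    calc (12 * S * G * D) ^ 2 = K * (864 * d * G ^ 2 * D ^ 2) := by
          rw [show (12 * S * G * D) ^ 2 = 144 * S ^ 2 * G ^ 2 * D ^ 2 by ring, hS2]; ring
      _ ≤ K * (K * ε ^ 2) := by gcongr
      _ = _ := by ring
  -- The second lower bound on K, of which the summand 8 is not needed.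
  have e3 : 6 * D * d ^ 2 * L ^ 2 * M₂ ≤ S * G * K * ε := by
    refine le_of_sq_le_sq ?_ (by positivity)
    calc (6 * D * d ^ 2 * L ^ 2 * M₂) ^ 2 = (6 * (d : ℝ) ^ 2) ^ 2 * (L ^ 4 * M₂ ^ 2 * D ^ 2) := by
          ring
      _ ≤ (6 * (d : ℝ) ^ 2 + 8) ^ 2 * (L ^ 4 * M₂ ^ 2 * D ^ 2) := by
          gcongr
          linarith
      _ = (6 * (d : ℝ) ^ 2 + 8) ^ 2 * L ^ 4 * M₂ ^ 2 * D ^ 2 := by ring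
      _ ≤ (K : ℝ) ^ 3 * (6 * d * G ^ 2 * ε ^ 2) := hB'
      _ = (S * G * K * ε) ^ 2 := by
          rw [show (S * G * K * ε) ^ 2 = S ^ 2 * (G * K * ε) ^ 2 by ring, hS2]; ring
  refine ⟨hη0, ?_⟩
  have t2 : D ^ 2 / 2 ≤ η * (K * ε / 4) := by
    have h1 : D ^ 2 / 2 = η * (12 * S * G * D) / 4 := by rw [sq]; nth_rw 1 [← hηS]; ring
    rw [h1]
    nlinarith
  have t3 : 4 * η * d * G ^ 2 * K ≤ K * ε / 108 := by
    have h1 : 4 * η * d * G ^ 2 * K = S * G * D / 9 := by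
      rw [← hηS, show 4 * η * d * G ^ 2 * K = 4 * η * G ^ 2 * (6 * d * K) / 6 by ring, ← hS2]
      ring
    rw [h1]
    linarith
  have t4 : 4 * η * (d : ℝ) ^ 2 * L ^ 2 * M₂ ≤ K * ε / 9 := by
    have h1 : η * (6 * D * d ^ 2 * L ^ 2 * M₂) ≤ D * (K * ε) / 6 := by
      calc _ ≤ η * (S * G * K * ε) := by gcongr
        _ = η * (6 * S * G) * (K * ε) / 6 := by ring
        _ = _ := by rw [hηS]
    have h2 : D * (η * (6 * d ^ 2 * L ^ 2 * M₂)) ≤ D * (K * ε / 6) := by linarith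
    have h3 := le_of_mul_le_mul_left h2 hD
    linarith
  -- The shares 1/4, 1/864, 1/108, 1/9 and 1/2 of ηKε add up to less than 1; the last one is the
  -- third lower bound on K.
  calc _ = D ^ 2 / 2 + η * (G * D + 4 * η * d * G ^ 2 * K + 4 * η * (d : ℝ) ^ 2 * L ^ 2 * M₂
        + 2 * L * M₁ * D) := by ring
    _ ≤ η * (K * ε / 4) + η * (K * ε / 864 + K * ε / 108 + K * ε / 9 + K * ε / 2) := by
        gcongr
        linarith
    _ ≤ _ := by
        rw [← mul_add]
        gcongr
        have : 0 < K * ε := by positivity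
        linarith

/-- The iteration bound is of order `d / ε²`. -/
theorem iterBound_le {d : ℕ} (hd : 1 ≤ d) {G L D M₁ M₂ ε : ℝ} (hG : 0 < G)
    (hε : 0 < ε) (hε1 : ε ≤ 1) :
    iterBound d G L D M₁ M₂ ε
      ≤ (864 * G ^ 2 * D ^ 2 + (196 * (L ^ 4 * M₂ ^ 2 * D ^ 2) / (6 * G ^ 2)) ^ (1 / 3 : ℝ)
        + 4 * |L * M₁ * D|) * (d / ε ^ 2) := by
  have hd' : (1 : ℝ) ≤ d := by exact_mod_cast hd
  have hε2 : ε ^ 2 ≤ ε := by nlinarith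
  set B := L ^ 4 * M₂ ^ 2 * D ^ 2 with hB
  have hB0 : 0 ≤ B := by positivity
  have hc : 0 ≤ (196 * B / (6 * G ^ 2)) ^ (1 / 3 : ℝ) := Real.rpow_nonneg (by positivity) _
  have hq : 0 ≤ d / ε ^ 2 := by positivity
  have h1 : 864 * d * G ^ 2 * D ^ 2 / ε ^ 2 = 864 * G ^ 2 * D ^ 2 * (d / ε ^ 2) := by ring
  have h2 : ((6 * (d : ℝ) ^ 2 + 8) ^ 2 * L ^ 4 * M₂ ^ 2 * D ^ 2 / (6 * d * G ^ 2 * ε ^ 2))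
      ^ (1 / 3 : ℝ) ≤ (196 * B / (6 * G ^ 2)) ^ (1 / 3 : ℝ) * (d / ε ^ 2) := by
    have h3 : (d / ε ^ 2 : ℝ) = ((d / ε ^ 2 : ℝ) ^ 3) ^ (1 / 3 : ℝ) := by
      generalize (d / ε ^ 2 : ℝ) = q at hq
      rw [← Real.rpow_natCast, ← Real.rpow_mul hq]
      norm_num
    rw [h3, ← Real.mul_rpow (by positivity) (by positivity)]
    refine Real.rpow_le_rpow (by positivity) ?_ (by norm_num)
    -- From d ≥ 1, with 196 = 14². After division by d the radicand grows like d³, so its cube root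
    -- is linear in d; for ε ≤ 1, weakening ε⁻² to ε⁻⁶ gives the uniform form d/ε².
    have h4 : (6 * (d : ℝ) ^ 2 + 8) ^ 2 ≤ 196 * (d : ℝ) ^ 4 := by
      have : (6 * (d : ℝ) ^ 2 + 8) ^ 2 ≤ (14 * (d : ℝ) ^ 2) ^ 2 := by
        gcongr
        nlinarith
      linarith
    have h5 : 1 / ε ^ 2 ≤ 1 / ε ^ 6 := by
      gcongr 1 / ?_
      exact pow_le_pow_of_le_one hε.le hε1 (by norm_num)
    calc _ = (6 * (d : ℝ) ^ 2 + 8) ^ 2 * (B / (6 * d * G ^ 2 * ε ^ 2)) := by rw [hB]; ring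
      _ ≤ 196 * (d : ℝ) ^ 4 * (B / (6 * d * G ^ 2 * ε ^ 2)) := by gcongr
      _ = 196 * (d : ℝ) ^ 3 * B / (6 * G ^ 2) * (1 / ε ^ 2) := by field_simp
      _ ≤ 196 * (d : ℝ) ^ 3 * B / (6 * G ^ 2) * (1 / ε ^ 6) := by gcongr
      _ = _ := by field_simp
  have h6 : 4 * L * M₁ * D / ε ≤ 4 * |L * M₁ * D| * (d / ε ^ 2) := by
    calc 4 * L * M₁ * D / ε = 4 * (L * M₁ * D) * (1 / ε) := by ring
      _ ≤ 4 * |L * M₁ * D| * (d / ε ^ 2) := by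
          gcongr
          exact le_abs_self _
  rw [iterBound]
  have h7 : 0 ≤ 864 * G ^ 2 * D ^ 2 * (d / ε ^ 2) := by positivity
  have h8 : 0 ≤ (196 * B / (6 * G ^ 2)) ^ (1 / 3 : ℝ) * (d / ε ^ 2) := mul_nonneg hc hq
  have h9 : 0 ≤ 4 * |L * M₁ * D| * (d / ε ^ 2) := by positivity
  rw [add_mul, add_mul]
  refine max_le (max_le ?_ ?_) ?_ <;> linarith

end Arithmetic

/-! ### The averaged iterate -/

section Average

variable {dx dy : ℕ} {X : Set (Vec dx)} {Y : Set (Vec dy)} {φ₀ : Vec dx → ℝ}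
  {φ : Fin dy → Vec dx → ℝ}

theorem isCompact_prodSet (hX : IsCompact X) (hY : IsCompact Y) : IsCompact (prodSet X Y) := by
  have h : prodSet X Y = (fun p : Vec dx × Vec dy => mk p.1 p.2) '' (X ×ˢ Y) := by
    ext z
    constructor
    · intro hz
      exact ⟨(z.fst, z.snd), hz, rfl⟩
    · rintro ⟨p, hp, rfl⟩
      exact hp
  rw [h]
  exact (hX.prod hY).image continuous_mk

theorem convex_prodSet (hX : Convex ℝ X) (hY : Convex ℝ Y) : Convex ℝ (prodSet X Y) :=
  fun _ h₁ _ h₂ _ _ ha hb hab => ⟨hX h₁.1 h₂.1 ha hb hab, hY h₁.2 h₂.2 ha hb hab⟩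

/-- The first term of the gap is convex in x and the second affine in y, so the gap is jointly
convex and Jensen applies to the average. -/
theorem convexOn_gap (hf : ∀ y ∈ Y, ConvexOn ℝ X fun x => lagrangian φ₀ φ (mk x y))
    (hX : Convex ℝ X) (hY : Convex ℝ Y) {u : PD dx dy} (hu : u ∈ prodSet X Y) :
    ConvexOn ℝ (prodSet X Y) (gap (lagrangian φ₀ φ) u) := by
  refine ⟨convex_prodSet hX hY, fun z₁ h₁ z₂ h₂ a b ha hb hab => ?_⟩
  have h3 := (hf u.snd hu.2).2 h₁.1 h₂.1 ha hb hab
  have h4 : lagrangian φ₀ φ (mk u.fst (a • z₁.snd + b • z₂.snd))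
      = a * lagrangian φ₀ φ (mk u.fst z₁.snd) + b * lagrangian φ₀ φ (mk u.fst z₂.snd) := by
    simp only [lagrangian_mk, PiLp.add_apply, PiLp.smul_apply, smul_eq_mul, add_mul,
      Finset.sum_add_distrib, mul_assoc, ← Finset.mul_sum]
    linear_combination (-φ₀ u.fst) * hab
  change lagrangian φ₀ φ (mk (a • z₁.fst + b • z₂.fst) u.snd)
    - lagrangian φ₀ φ (mk u.fst (a • z₁.snd + b • z₂.snd)) ≤ _
  simp only [smul_eq_mul] at h3
  rw [h4]
  simp only [gap, smul_eq_mul]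
  linarith

variable {Ω : Type*} {mΩ : MeasurableSpace Ω} {P : Measure Ω} [IsProbabilityMeasure P]
  {v w : ℕ → Ω → PD dx dy} {r : ℕ → ℝ} {z₀ u : PD dx dy} {h : PD dx dy → ℝ}
  {G L D ρ M₁ M₂ ε : ℝ} {μ : Measure (PD dx dy)}

theorem average_mem {E : Type*} [AddCommGroup E] [Module ℝ E] {Z : Set E} (hZ : Convex ℝ Z)
    {K : ℕ} (hK : 1 ≤ K) {y : ℕ → E} (hy : ∀ i, y i ∈ Z) :
    (K : ℝ)⁻¹ • ∑ i ∈ Finset.range K, y i ∈ Z := by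
  rw [Finset.smul_sum]
  have hK' : (K : ℝ) ≠ 0 := by positivity
  exact hZ.sum_mem (fun _ _ => by positivity) (by simp [hK']) fun i _ => hy i

/-- The averaged iterate has expected gap at most `ε` relative to every comparison point. -/
theorem integral_gap_average_le (hXc : IsCompact X) (hXcv : Convex ℝ X) (hYc : IsCompact Y)
    (hYcv : Convex ℝ Y) (hf : ∀ y ∈ Y, ConvexOn ℝ X fun x => lagrangian φ₀ φ (mk x y))
    (hdiam : ∀ z₁ ∈ prodSet X Y, ∀ z₂ ∈ prodSet X Y, ‖z₁ - z₂‖ ≤ D)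
    (hreg : IsRegularNear (lagrangian φ₀ φ) (prodSet X Y) G L ρ) (hG : 0 < G) (hL : 0 ≤ L)
    (hr : ∀ k, 0 < r k) (hrρ : ∀ k, r k ≤ ρ)
    (hM₁ : HasSum (fun k => r (k + 1)) M₁) (hM₂ : HasSum (fun k => r (k + 1) ^ 2) M₂)
    (hh : Continuous h)
    (hfh : ∀ z ∈ prodSet X Y, ∀ x ∈ Metric.closedBall z ρ, lagrangian φ₀ φ x = h x)
    (hμ : IsRotationInvariantOnSphere μ) (hd : 1 ≤ dx + dy)
    (hvm : ∀ k, Measurable (v k)) (hwm : ∀ k, Measurable (w k))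
    (hv1 : ∀ k ω, ‖v k ω‖ = 1) (hw1 : ∀ k ω, ‖w k ω‖ = 1)
    (hvlaw : ∀ k, P.map (v k) = μ) (hwlaw : ∀ k, P.map (w k) = μ)
    (hind : iIndepFun (Sum.elim v w) P) (hz₀ : z₀ ∈ prodSet X Y) (hu : u ∈ prodSet X Y)
    (hgapGD : ∀ z ∈ prodSet X Y, gap (lagrangian φ₀ φ) u z ≤ G * D) (hε : 0 < ε)
    {K : ℕ} (hK1 : 1 ≤ K) (hK : iterBound (dx + dy) G L D M₁ M₂ ε ≤ K) :
    ∫ ω, gap (lagrangian φ₀ φ) u ((K : ℝ)⁻¹ • ∑ i ∈ Finset.range K,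
      iteratePlus h (prodSet X Y) (stepSize (dx + dy) K G D) r z₀ (fun i => v i ω)
        (fun i => w i ω) i) ∂P ≤ ε := by
  have hZ := isCompact_prodSet hXc hYc
  have hcv := convex_prodSet hXcv hYcv
  have hne : (prodSet X Y).Nonempty := ⟨_, hz₀⟩
  have hcl := hZ.isClosed
  set f := lagrangian φ₀ φ with hfdef
  set η := stepSize (dx + dy) K G D with hη
  set Yk : ℕ → Ω → PD dx dy := fun k ω =>
    iteratePlus h (prodSet X Y) η r z₀ (fun i => v i ω) (fun i => w i ω) k with hYk
  have hρ : 0 ≤ ρ := (hr 0).le.trans (hrρ 0)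
  have hYm : ∀ k, Measurable (Yk k) := fun k =>
    measurable_iteratePlus hne hcl hcv hh k (fun i _ => hvm i) (fun i _ => hwm i)
  have hYZ : ∀ k ω, Yk k ω ∈ prodSet X Y := fun k ω => extrapolate_mem hne hcl hcv _ _
  have hgap_eq : ∀ z ∈ prodSet X Y, gap f u z = gap h u z := by
    intro z hz
    have h1 : ∀ z ∈ prodSet X Y, f z = h z := fun z hz =>
      hfh z hz z (Metric.mem_closedBall_self hρ)
    rw [gap, gap, h1 _ (⟨hz.1, hu.2⟩ : mk z.fst u.snd ∈ prodSet X Y),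
      h1 _ (⟨hu.1, hz.2⟩ : mk u.fst z.snd ∈ prodSet X Y)]
  have hK' : (0 : ℝ) < K := by exact_mod_cast hK1
  have hgap_int : ∀ k, Integrable (fun ω => gap h u (Yk k ω)) P := fun k =>
    integrable_of_mem_compact (hYm k) hZ (hYZ k) (continuous_gap hh u)
  have hAm : Measurable fun ω => (K : ℝ)⁻¹ • ∑ i ∈ Finset.range K, Yk i ω :=
    (continuous_const_smul (K : ℝ)⁻¹).measurable.comp
      (Finset.measurable_sum _ fun i _ => hYm i)
  have hAZ : ∀ ω, (K : ℝ)⁻¹ • ∑ i ∈ Finset.range K, Yk i ω ∈ prodSet X Y := fun ω =>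
    average_mem hcv hK1 fun i => hYZ i ω
  have hAint : Integrable
      (fun ω => gap f u ((K : ℝ)⁻¹ • ∑ i ∈ Finset.range K, Yk i ω)) P :=
    (integrable_of_mem_compact hAm hZ hAZ (continuous_gap hh u)).congr
      (Filter.Eventually.of_forall fun ω => (hgap_eq _ (hAZ ω)).symm)
  change ∫ ω, gap f u ((K : ℝ)⁻¹ • ∑ i ∈ Finset.range K, Yk i ω) ∂P ≤ ε
  -- If GD ≤ ε every point of `Z` has small enough gap. Otherwise ε < GD, which is what allows the
  -- crude charge GD for iteration 0.
  rcases le_or_gt (G * D) ε with hGD | hGD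
  · calc _ ≤ ∫ _, ε ∂P :=
          integral_mono hAint (integrable_const ε) fun ω => (hgapGD _ (hAZ ω)).trans hGD
      _ = ε := by simp
  obtain ⟨hη0, hbudget⟩ := stepSize_budget hd hG hε hGD hK1 hK
  rw [← hη] at hη0 hbudget
  have hD : 0 ≤ D := by simpa using hdiam z₀ hz₀ z₀ hz₀
  have hstep := fun k => integral_gap_iteratePlus_le (P := P) (r := r) hZ hcv hz₀ hu hh hη0.le
    hvm hwm hv1 hw1 hvlaw hwlaw hind k (β := 2 * L * r k * D)
    (V := 2 * (dx + dy : ℕ) * G ^ 2 + 2 * ((dx + dy : ℕ) : ℝ) ^ 2 * L ^ 2 * r k ^ 2)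
    (fun z hz => by
      have h1 := integral_gap_sub_inner_gradEst_le hμ hreg hL (hr k) (hrρ k) hh hfh hz
        (u := u) (by
          rw [← hgap_eq z hz]
          exact lagrangian_gap_le φ₀ φ hz.1 hu.1 (hf _ hz.2)
            (hreg.differentiableAt z hz z (Metric.mem_closedBall_self hρ)))
      refine h1.trans ?_
      have h2 := (hr k).le
      have h3 := hdiam z hz u hu
      gcongr)
    (fun z hz => integral_norm_gradEst_sq_le hμ hreg hL (hr k) (hrρ k) hfh hz)
  set a : ℕ → ℝ := fun k => (∫ ω, ‖iterate h (prodSet X Y) η r z₀ (fun i => v i ω)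
    (fun i => w i ω) k - u‖ ^ 2 ∂P) / 2 with ha
  have ha0 : ∀ k, 0 ≤ a k := fun k => by
    have : 0 ≤ ∫ ω, ‖iterate h (prodSet X Y) η r z₀ (fun i => v i ω)
      (fun i => w i ω) k - u‖ ^ 2 ∂P := integral_nonneg fun ω => sq_nonneg _
    simp only [ha]
    positivity
  have ha1 : a 1 ≤ D ^ 2 / 2 := by
    have h1 : ∫ ω, ‖iterate h (prodSet X Y) η r z₀ (fun i => v i ω)
        (fun i => w i ω) 1 - u‖ ^ 2 ∂P ≤ D ^ 2 := by
      have h2 : Measurable fun ω => iterate h (prodSet X Y) η r z₀ (fun i => v i ω)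
          (fun i => w i ω) 1 :=
        measurable_iterate hne hcl hcv hh 1 (fun i _ => hvm i) (fun i _ => hwm i)
      calc _ ≤ ∫ _, D ^ 2 ∂P := by
            refine integral_mono (integrable_of_mem_compact h2 hZ
              (fun ω => iterate_mem hne hcl hcv hz₀ 1) (ψ := fun z => ‖z - u‖ ^ 2)
              (by fun_prop)) (integrable_const _) fun ω => ?_
            exact pow_le_pow_left₀ (norm_nonneg _)
              (hdiam _ (iterate_mem hne hcl hcv hz₀ 1) _ hu) 2
        _ = _ := by simp
    simp only [ha]
    linarith
  -- Iteration 0 is separated from the m iterations whose radii are summed; the telescoping then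
  -- starts from `a 1`.
  obtain ⟨m, rfl⟩ : ∃ m, K = m + 1 := ⟨K - 1, by omega⟩
  have htel := sum_range_succ_le_of_telescope (a := a)
    (g := fun k => η * ∫ ω, gap h u (Yk k ω) ∂P)
    (e := fun k => 2 * η ^ 2 * (2 * (dx + dy : ℕ) * G ^ 2
      + 2 * ((dx + dy : ℕ) : ℝ) ^ 2 * L ^ 2 * r k ^ 2) + η * (2 * L * r k * D))
    (fun k => by
      have := hstep k
      simp only [ha, hYk]
      linarith) m
  have hg0 : ∫ ω, gap h u (Yk 0 ω) ∂P ≤ G * D := by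
    calc _ ≤ ∫ _, G * D ∂P := integral_mono (hgap_int 0) (integrable_const _) fun ω => by
            simp only [← hgap_eq _ (hYZ 0 ω)]
            exact hgapGD _ (hYZ 0 ω)
      _ = _ := by simp
  have hr1 : ∑ k ∈ Finset.range m, r (k + 1) ≤ M₁ :=
    sum_le_hasSum _ (fun k _ => (hr _).le) hM₁
  have hr2 : ∑ k ∈ Finset.range m, r (k + 1) ^ 2 ≤ M₂ :=
    sum_le_hasSum _ (fun k _ => sq_nonneg _) hM₂
  have hsum_e : ∑ k ∈ Finset.range m, (2 * η ^ 2 * (2 * (dx + dy : ℕ) * G ^ 2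
      + 2 * ((dx + dy : ℕ) : ℝ) ^ 2 * L ^ 2 * r (k + 1) ^ 2) + η * (2 * L * r (k + 1) * D))
      ≤ 2 * η ^ 2 * (2 * (dx + dy : ℕ) * G ^ 2 * (m + 1 : ℕ)
        + 2 * ((dx + dy : ℕ) : ℝ) ^ 2 * L ^ 2 * M₂) + η * (2 * L * M₁ * D) := by
    have h1 : ∑ k ∈ Finset.range m, (2 * η ^ 2 * (2 * (dx + dy : ℕ) * G ^ 2
        + 2 * ((dx + dy : ℕ) : ℝ) ^ 2 * L ^ 2 * r (k + 1) ^ 2) + η * (2 * L * r (k + 1) * D))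
        = 2 * η ^ 2 * (2 * (dx + dy : ℕ) * G ^ 2 * m + 2 * ((dx + dy : ℕ) : ℝ) ^ 2 * L ^ 2
          * ∑ k ∈ Finset.range m, r (k + 1) ^ 2)
          + η * (2 * L * (∑ k ∈ Finset.range m, r (k + 1)) * D) := by
      simp only [Finset.sum_add_distrib, ← Finset.mul_sum, ← Finset.sum_mul, mul_add,
        Finset.sum_const, Finset.card_range, nsmul_eq_mul]
      ring
    rw [h1]
    gcongr
    simp
  have hfin : η * ∑ k ∈ Finset.range (m + 1), ∫ ω, gap h u (Yk k ω) ∂P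
      ≤ η * ((m + 1 : ℕ) * ε) := by
    rw [Finset.mul_sum]
    have h1 := mul_le_mul_of_nonneg_left hg0 hη0.le
    have h2 := ha0 (m + 1)
    linarith
  have hfin' := le_of_mul_le_mul_left hfin hη0
  calc _ ≤ ∫ ω, ∑ i ∈ Finset.range (m + 1), ((m + 1 : ℕ) : ℝ)⁻¹ * gap h u (Yk i ω) ∂P := by
        refine integral_mono hAint (integrable_finsetSum _ fun i _ => (hgap_int i).const_mul _)
          fun ω => ?_
        have h1 := (convexOn_gap hf hXcv hYcv hu).map_sum_le (t := Finset.range (m + 1))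
          (w := fun _ => ((m + 1 : ℕ) : ℝ)⁻¹) (p := fun i => Yk i ω)
          (fun _ _ => by positivity)
          (by simp only [Finset.sum_const, Finset.card_range, nsmul_eq_mul]
              exact mul_inv_cancel₀ hK'.ne') (fun i _ => hYZ i ω)
        rw [← Finset.smul_sum] at h1
        refine h1.trans_eq (Finset.sum_congr rfl fun i _ => ?_)
        rw [smul_eq_mul, ← hgap_eq _ (hYZ i ω)]
    _ = ((m + 1 : ℕ) : ℝ)⁻¹ * ∑ k ∈ Finset.range (m + 1), ∫ ω, gap h u (Yk k ω) ∂P := by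
        rw [integral_finsetSum _ fun i _ => (hgap_int i).const_mul _, Finset.mul_sum]
        exact Finset.sum_congr rfl fun i _ => integral_const_mul _ _
    _ ≤ ε := by
        rw [inv_mul_le_iff₀ hK']
        exact hfin'

end Average

/-! ### From the gap to the constrained problem -/

section Guarantees

variable {dx dy : ℕ} {X : Set (Vec dx)} {Y : Set (Vec dy)} {φ₀ : Vec dx → ℝ}
  {φ : Fin dy → Vec dx → ℝ} {h : PD dx dy → ℝ} {ρ ε : ℝ} {xs : Vec dx} {ys : Vec dy}

theorem norm_mk_sub_mk_right (x : Vec dx) (y₁ y₂ : Vec dy) :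
    ‖mk x y₁ - mk x y₂‖ = ‖y₁ - y₂‖ := by
  simp [mk, WithLp.prod_norm_eq_of_L2]

/-- The constraint functions agree on `Z` with continuous functions. -/
theorem exists_continuous_eq_constraint (hρ : 0 < ρ) (hh : Continuous h)
    (hfh : ∀ z ∈ prodSet X Y, ∀ x ∈ Metric.closedBall z ρ, lagrangian φ₀ φ x = h x)
    (hys : ys ∈ Y) (j : Fin dy) :
    ∃ ψ : PD dx dy → ℝ, Continuous ψ ∧ ∀ z ∈ prodSet X Y, φ j z.fst = ψ z := by
  have hc : ∀ y : Vec dy, Continuous fun z : PD dx dy => h (mk z.fst y) := fun y =>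
    hh.comp (continuous_mk.comp (continuous_fst_PD.prodMk continuous_const))
  let e : Vec dy := EuclideanSpace.single j 1
  -- f is affine in y, so φ_j is its difference quotient along e_j. The step ρ stays in the
  -- neighbourhood of `Z` where f = h, even if y* + ρ e_j lies outside Y.
  refine ⟨fun z => (h (mk z.fst (ys + ρ • e)) - h (mk z.fst ys)) / ρ,
    ((hc _).sub (hc _)).div_const ρ, fun z hz => ?_⟩
  have hz' : mk z.fst ys ∈ prodSet X Y := ⟨hz.1, hys⟩
  have h1 : mk z.fst (ys + ρ • e) ∈ Metric.closedBall (mk z.fst ys) ρ := by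
    rw [mem_closedBall_iff_norm, norm_mk_sub_mk_right, add_sub_cancel_left, norm_smul,
      Real.norm_of_nonneg hρ.le]
    simp [e]
  simp only
  rw [← hfh _ hz' _ h1, ← hfh _ hz' _ (Metric.mem_closedBall_self hρ.le), lagrangian_mk,
    lagrangian_mk]
  have h2 : ∑ i, (ys + ρ • e) i * φ i z.fst = ∑ i, ys i * φ i z.fst + ρ * φ j z.fst := by
    simp [e, add_mul, Finset.sum_add_distrib]
  rw [h2]
  field_simp
  ring

/-- The objective agrees on `Z` with a continuous function. -/
theorem exists_continuous_eq_objective (hρ : 0 < ρ) (hh : Continuous h)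
    (hfh : ∀ z ∈ prodSet X Y, ∀ x ∈ Metric.closedBall z ρ, lagrangian φ₀ φ x = h x)
    (hys : ys ∈ Y) :
    ∃ ψ : PD dx dy → ℝ, Continuous ψ ∧ ∀ z ∈ prodSet X Y, φ₀ z.fst = ψ z := by
  choose ψ hψ hφψ using exists_continuous_eq_constraint hρ hh hfh hys
  have hc : Continuous fun z : PD dx dy => h (mk z.fst ys) :=
    hh.comp (continuous_mk.comp (continuous_fst_PD.prodMk continuous_const))
  refine ⟨fun z => h (mk z.fst ys) - ∑ j, ys j * ψ j z,
    hc.sub (continuous_finsetSum _ fun j _ => (hψ j).const_mul _), fun z hz => ?_⟩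
  simp only
  rw [← hfh (mk z.fst ys) ⟨hz.1, hys⟩ _ (Metric.mem_closedBall_self hρ.le), lagrangian_mk]
  simp [← hφψ _ z hz]

variable {Ω : Type*} {mΩ : MeasurableSpace Ω} {P : Measure Ω} {ζ : Ω → PD dx dy}

theorem integrable_of_eq_continuous [IsFiniteMeasure P] {Z : Set (PD dx dy)} (hZ : IsCompact Z)
    (hζ : AEMeasurable ζ P) (hζZ : ∀ᵐ ω ∂P, ζ ω ∈ Z) {g ψ : PD dx dy → ℝ} (hψ : Continuous ψ)
    (hgψ : ∀ z ∈ Z, g z = ψ z) : Integrable (fun ω => g (ζ ω)) P := by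
  obtain ⟨B, hB⟩ := hZ.exists_bound_of_continuousOn hψ.continuousOn
  have h1 : Integrable (fun ω => ψ (ζ ω)) P :=
    Integrable.of_bound (hψ.measurable.comp_aemeasurable hζ).aestronglyMeasurable B
      (hζZ.mono fun ω hω => hB _ hω)
  exact h1.congr (hζZ.mono fun ω hω => (hgψ _ hω).symm)

theorem dualityGap_eq_gap (f : PD dx dy → ℝ) (z : PD dx dy) :
    dualityGap f xs ys z = gap f (mk xs ys) z := rfl

/-- The expected constraint violation. -/
theorem norm_posPart_integral_le (hxs : xs ∈ X)
    (hsaddle : IsSaddlePointOn X Y (fun x y => lagrangian φ₀ φ (mk x y)) xs ys)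
    (hζZ : ∀ᵐ ω ∂P, ζ ω ∈ prodSet X Y) (hε : 0 < ε)
    (hφ_int : ∀ j, Integrable (fun ω => φ j (ζ ω).fst) P)
    (hgap_int : Integrable (fun ω => gap (lagrangian φ₀ φ) (mk xs ys) (ζ ω)) P)
    (hgap : ∀ u ∈ prodSet X Y, ∫ ω, gap (lagrangian φ₀ φ) u (ζ ω) ∂P ≤ ε)
    {R : ℝ} (hR : 0 < R) (hball : ∀ u : Vec dy, ‖u‖ = 1 → ys + R • u ∈ Y) :
    ‖posPart (WithLp.toLp 2 (fun j => ∫ ω, φ j (ζ ω).fst ∂P))‖ ≤ ε / R := by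
  set p : Vec dy := WithLp.toLp 2 (fun j => ∫ ω, φ j (ζ ω).fst ∂P) with hp
  set q := posPart p with hq
  rw [le_div_iff₀ hR]
  rcases eq_or_ne q 0 with hq0 | hq0
  · rw [hq0, norm_zero, zero_mul]
    exact hε.le
  have hqn : 0 < ‖q‖ := norm_pos_iff.2 hq0
  -- The dual comparison point is pushed by R along q. As q comes from expectations it is
  -- deterministic, so the gap bound applies; relative to the saddle point the gap gains R⟪q,
  -- φ⟫/‖q‖, of mean R‖q‖.
  have hy : ys + R • (‖q‖⁻¹ • q) ∈ Y :=
    hball _ (by rw [norm_smul, norm_inv, norm_norm, inv_mul_cancel₀ hqn.ne'])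
  have hpt : ∀ z : PD dx dy, gap (lagrangian φ₀ φ) (mk xs (ys + R • (‖q‖⁻¹ • q))) z
      = gap (lagrangian φ₀ φ) (mk xs ys) z
        + R * ‖q‖⁻¹ * ∑ j, q j * φ j z.fst := by
    intro z
    change lagrangian φ₀ φ (mk z.fst (ys + R • (‖q‖⁻¹ • q)))
      - lagrangian φ₀ φ (mk xs z.snd) = lagrangian φ₀ φ (mk z.fst ys)
      - lagrangian φ₀ φ (mk xs z.snd) + _
    simp only [lagrangian_mk, PiLp.add_apply, PiLp.smul_apply, smul_eq_mul, add_mul,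
      Finset.sum_add_distrib, mul_assoc, ← Finset.mul_sum]
    ring
  have hu : mk xs (ys + R • (‖q‖⁻¹ • q)) ∈ prodSet X Y := ⟨hxs, hy⟩
  have h1 := hgap _ hu
  have hqφ : ∀ j, Integrable (fun ω => q j * φ j (ζ ω).fst) P := fun j =>
    (hφ_int j).const_mul _
  simp_rw [hpt] at h1
  rw [integral_add (hgap_int) ((integrable_finsetSum _ fun j _ => hqφ j).const_mul _),
    integral_const_mul, integral_finsetSum _ fun j _ => hqφ j] at h1
  have h2 : ∑ j, ∫ ω, q j * φ j (ζ ω).fst ∂P = ‖q‖ ^ 2 := by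
    rw [EuclideanSpace.norm_sq_eq]
    refine Finset.sum_congr rfl fun j _ => ?_
    rw [integral_const_mul, Real.norm_eq_abs, sq_abs]
    -- A vector paired with its positive part gives the squared norm of that part.
    change max (p j) 0 * p j = max (p j) 0 ^ 2
    rcases le_total (p j) 0 with hj | hj
    · simp [hj]
    · rw [max_eq_left hj, sq]
  have h3 : 0 ≤ ∫ ω, gap (lagrangian φ₀ φ) (mk xs ys) (ζ ω) ∂P :=
    integral_nonneg_of_ae (hζZ.mono fun ω hω => sub_nonneg.2 (hsaddle _ hω.1 _ hω.2))
  have h4 : R * ‖q‖⁻¹ * ‖q‖ ^ 2 = ‖q‖ * R := by field_simp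
  rw [h2, h4] at h1
  linarith

variable [IsProbabilityMeasure P]

/-- The expected objective gap. -/
theorem integral_objective_sub_le (hxs : xs ∈ X)
    (hsaddle : IsSaddlePointOn X Y (fun x y => lagrangian φ₀ φ (mk x y)) xs ys)
    (hζZ : ∀ᵐ ω ∂P, ζ ω ∈ prodSet X Y) (hφ₀_int : Integrable (fun ω => φ₀ (ζ ω).fst) P)
    (hgap_int : Integrable (fun ω => gap (lagrangian φ₀ φ) (mk xs 0) (ζ ω)) P)
    (hgap : ∀ u ∈ prodSet X Y, ∫ ω, gap (lagrangian φ₀ φ) u (ζ ω) ∂P ≤ ε)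
    (h0 : (0 : Vec dy) ∈ Y) (hys0 : ∀ j, 0 ≤ ys j) {xo : Vec dx} (hxo : xo ∈ feasibleSet X φ) :
    ∫ ω, φ₀ (ζ ω).fst ∂P - φ₀ xo ≤ ε := by
  have hu : mk xs (0 : Vec dy) ∈ prodSet X Y := ⟨hxs, h0⟩
  have h1 := hgap _ hu
  have h2 : ∫ ω, (φ₀ (ζ ω).fst - φ₀ xo) ∂P
      ≤ ∫ ω, gap (lagrangian φ₀ φ) (mk xs 0) (ζ ω) ∂P := by
    refine integral_mono_ae (hφ₀_int.sub (integrable_const _)) (hgap_int) ?_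
    filter_upwards [hζZ] with ω hω
    -- The saddle inequality at a feasible point, followed by y* ≥ 0 and φ_j(xo) ≤ 0, gives f(x*, y)
    -- ≤ f(xo, y*) ≤ φ₀(xo).
    have h3 : lagrangian φ₀ φ (mk xs (ζ ω).snd) ≤ lagrangian φ₀ φ (mk xo ys) :=
      hsaddle _ hxo.1 _ hω.2
    have h4 : ∑ j, ys j * φ j xo ≤ 0 :=
      Finset.sum_nonpos fun j _ => mul_nonpos_of_nonneg_of_nonpos (hys0 j) (hxo.2 j)
    have h5 : lagrangian φ₀ φ (mk (ζ ω).fst 0) = φ₀ (ζ ω).fst := by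
      simp [lagrangian_mk]
    change _ ≤ lagrangian φ₀ φ (mk (ζ ω).fst 0) - lagrangian φ₀ φ (mk xs (ζ ω).snd)
    rw [lagrangian_mk φ₀ φ xo ys] at h3
    linarith
  rw [integral_sub hφ₀_int (integrable_const _)] at h2
  simp only [integral_const, probReal_univ, smul_eq_mul, one_mul] at h2
  linarith

/-- Small expected gaps relative to all comparison points yield the guarantees for the
constrained problem. -/
theorem guarantees_of_integral_gap_le (hXc : IsCompact X) (hYc : IsCompact Y)
    (hρ : 0 < ρ) (hh : Continuous h)
    (hfh : ∀ z ∈ prodSet X Y, ∀ x ∈ Metric.closedBall z ρ, lagrangian φ₀ φ x = h x)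
    (hxs : xs ∈ X) (hys : ys ∈ Y)
    (hsaddle : IsSaddlePointOn X Y (fun x y => lagrangian φ₀ φ (mk x y)) xs ys)
    (hζ : AEMeasurable ζ P) (hζZ : ∀ᵐ ω ∂P, ζ ω ∈ prodSet X Y) (hε : 0 < ε)
    (hgap : ∀ u ∈ prodSet X Y, ∫ ω, gap (lagrangian φ₀ φ) u (ζ ω) ∂P ≤ ε) :
    (Integrable (fun ω => dualityGap (lagrangian φ₀ φ) xs ys (ζ ω)) P ∧
      (∀ j, Integrable (fun ω => φ j (ζ ω).fst) P) ∧
      Integrable (fun ω => φ₀ (ζ ω).fst) P) ∧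
    ∫ ω, dualityGap (lagrangian φ₀ φ) xs ys (ζ ω) ∂P ≤ ε ∧
    (∀ R : ℝ, IsGreatest (innerRadii Y ys) R →
      ‖posPart (WithLp.toLp 2 (fun j => ∫ ω, φ j (ζ ω).fst ∂P))‖ ≤ ε / R) ∧
    ((0 : Vec dy) ∈ Y → (∀ j, 0 ≤ ys j) →
      ∀ φopt : ℝ, IsLeast (φ₀ '' feasibleSet X φ) φopt →
        ∫ ω, φ₀ (ζ ω).fst ∂P - φopt ≤ ε) := by
  have hZ := isCompact_prodSet hXc hYc
  have hfh' : ∀ z ∈ prodSet X Y, lagrangian φ₀ φ z = h z := fun z hz =>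
    hfh z hz z (Metric.mem_closedBall_self hρ.le)
  have hgap_int : ∀ u ∈ prodSet X Y,
      Integrable (fun ω => gap (lagrangian φ₀ φ) u (ζ ω)) P := by
    intro u hu
    refine integrable_of_eq_continuous hZ hζ hζZ (g := gap (lagrangian φ₀ φ) u)
      (continuous_gap hh u) fun z hz => ?_
    rw [gap, gap, hfh' _ (⟨hz.1, hu.2⟩ : mk z.fst u.snd ∈ prodSet X Y),
      hfh' _ (⟨hu.1, hz.2⟩ : mk u.fst z.snd ∈ prodSet X Y)]
  have hφ_int : ∀ j, Integrable (fun ω => φ j (ζ ω).fst) P := by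
    intro j
    obtain ⟨ψ, hψ, hφψ⟩ := exists_continuous_eq_constraint hρ hh hfh hys j
    exact integrable_of_eq_continuous hZ hζ hζZ (g := fun z => φ j z.fst) hψ hφψ
  have hφ₀_int : Integrable (fun ω => φ₀ (ζ ω).fst) P := by
    obtain ⟨ψ, hψ, hφψ⟩ := exists_continuous_eq_objective hρ hh hfh hys
    exact integrable_of_eq_continuous hZ hζ hζZ (g := fun z => φ₀ z.fst) hψ hφψ
  have hs : mk xs ys ∈ prodSet X Y := ⟨hxs, hys⟩
  simp only [dualityGap_eq_gap]
  refine ⟨⟨hgap_int _ hs, hφ_int, hφ₀_int⟩, hgap _ hs, ?_, ?_⟩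
  · rintro R ⟨⟨hR, hball⟩, -⟩
    exact norm_posPart_integral_le hxs hsaddle hζZ hε hφ_int (hgap_int _ hs) hgap hR hball
  · rintro h0 hys0 φopt ⟨⟨xo, hxo, rfl⟩, -⟩
    exact integral_objective_sub_le hxs hsaddle hζZ hφ₀_int (hgap_int _ ⟨hxs, h0⟩) hgap h0
      hys0 hxo

/-- Lipschitz and smoothness bounds on the closed neighbourhood of `Z`, seen from `Z`. -/
theorem isRegularNear_of_lipschitzFunOn {f : PD dx dy → ℝ} {Z : Set (PD dx dy)} {G L : ℝ}
    (hG : 0 < G) (hρ : 0 < ρ) (hLip : LipschitzFunOn f G (Metric.cthickening ρ Z))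
    (hSmooth : SmoothFunOn f L (Metric.cthickening ρ Z)) : IsRegularNear f Z G L ρ := by
  have hsub : ∀ z ∈ Z, Metric.closedBall z ρ ⊆ Metric.cthickening ρ Z := fun z hz =>
    Metric.closedBall_subset_cthickening hz ρ
  have hself : ∀ z ∈ Z, z ∈ Metric.cthickening ρ Z := fun z hz =>
    hsub z hz (Metric.mem_closedBall_self hρ.le)
  refine ⟨fun z hz x hx => hSmooth.1 x (hsub z hz hx), fun z hz => ?_,
    fun z hz x hx => hSmooth.2 x (hsub z hz hx) z (hself z hz)⟩
  have h1 := (hSmooth.1 z (hself z hz)).hasGradientAt.hasFDerivAt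
  have h2 := h1.le_of_lipschitzOn (C := ⟨G, hG.le⟩) (Metric.closedBall_mem_nhds z hρ)
    (LipschitzOnWith.of_dist_le_mul fun x hx y hy => by
      rw [Real.dist_eq, dist_eq_norm]
      exact hLip x (hsub z hz hx) y (hsub z hz hy))
  rw [LinearIsometryEquiv.norm_map] at h2
  exact h2

end Guarantees

end

end ZOEG

/-! ### The main theorem -/

theorem mainTheorem4 (G L D M₁ M₂ : ℝ) (hG : 0 < G) (hL : 0 ≤ L) :
    -- `C` bounds the oracle complexity; it depends on `G, L, D, M₁, M₂` only
    ∃ C : ℝ, ∀ (dx dy : ℕ)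
      -- the problem
      (X : Set (ZOEG.Vec dx)) (Y : Set (ZOEG.Vec dy))
      (φ₀ : ZOEG.Vec dx → ℝ) (φ : Fin dy → ZOEG.Vec dx → ℝ)
      (_hXc : IsCompact X) (_hXconv : Convex ℝ X)
      (_hYc : IsCompact Y) (_hYconv : Convex ℝ Y)
      (_hD : Metric.diam (ZOEG.prodSet X Y) = D)
      (_hφ₀ : ConvexOn ℝ X φ₀) (_hφ : ∀ j, ConvexOn ℝ X (φ j))
      (_hf : ∀ y ∈ Y, ConvexOn ℝ X (fun x => ZOEG.lagrangian φ₀ φ (ZOEG.mk x y)))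
      -- a saddle point of the Lagrangian over `X × Y`
      (xs : ZOEG.Vec dx) (ys : ZOEG.Vec dy) (_hxs : xs ∈ X) (_hys : ys ∈ Y)
      (_hsaddle : IsSaddlePointOn X Y
        (fun x y => ZOEG.lagrangian φ₀ φ (ZOEG.mk x y)) xs ys)
      -- the smoothing radii; the Lagrangian is regular wherever the algorithm may query it
      (r : ℕ → ℝ) (ρ : ℝ) (_hr : ∀ k, 0 < r k) (_hρ : ∀ k, r k ≤ ρ)
      (_hM₁ : HasSum (fun k => r (k + 1)) M₁) (_hM₂ : HasSum (fun k => r (k + 1) ^ 2) M₂)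
      (_hLip : ZOEG.LipschitzFunOn (ZOEG.lagrangian φ₀ φ) G
        (Metric.cthickening ρ (ZOEG.prodSet X Y)))
      (_hSmooth : ZOEG.SmoothFunOn (ZOEG.lagrangian φ₀ φ) L
        (Metric.cthickening ρ (ZOEG.prodSet X Y)))
      -- the initial point and the independent, uniformly distributed perturbations
      (z₀ : ZOEG.PD dx dy) (_hz₀ : z₀ ∈ ZOEG.prodSet X Y)
      (Ω : Type*) (_mΩ : MeasurableSpace Ω) (P : Measure Ω) (_hP : IsProbabilityMeasure P)
      (v w : ℕ → Ω → ZOEG.PD dx dy)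
      (_hv : ∀ k, HasLaw (v k) (ZOEG.uniformSphere dx dy) P)
      (_hw : ∀ k, HasLaw (w k) (ZOEG.uniformSphere dx dy) P)
      (_hindep : iIndepFun (Sum.elim v w) P)
      (ε : ℝ) (_hε : 0 < ε),
      -- the run of the algorithm with `K` iterations, and its output `ẑ_K`
      let alg : ℕ → Ω → ZOEG.OracleProg (ZOEG.PD dx dy) (ZOEG.PD dx dy) := fun K ω =>
        ZOEG.zoeg (ZOEG.prodSet X Y) (ZOEG.stepSize (dx + dy) K G D) r z₀
          (fun k => v k ω) (fun k => w k ω) K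
      let zhat : ℕ → Ω → ZOEG.PD dx dy := fun K ω =>
        (alg K ω).result (ZOEG.lagrangian φ₀ φ)
      (∀ K : ℕ, 1 ≤ K → ZOEG.iterBound (dx + dy) G L D M₁ M₂ ε ≤ K →
        -- the expectations below exist
        (Integrable (fun ω => ZOEG.dualityGap (ZOEG.lagrangian φ₀ φ) xs ys (zhat K ω)) P ∧
          (∀ j, Integrable (fun ω => φ j (zhat K ω).fst) P) ∧
          Integrable (fun ω => φ₀ (zhat K ω).fst) P) ∧
        -- duality gap
        ∫ ω, ZOEG.dualityGap (ZOEG.lagrangian φ₀ φ) xs ys (zhat K ω) ∂P ≤ ε ∧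
        -- constraint violation
        (∀ R : ℝ, IsGreatest (ZOEG.innerRadii Y ys) R →
          ‖ZOEG.posPart (WithLp.toLp 2 (fun j => ∫ ω, φ j (zhat K ω).fst ∂P))‖ ≤ ε / R) ∧
        -- objective gap to the optimal value of the constrained problem
        ((0 : ZOEG.Vec dy) ∈ Y → (∀ j, 0 ≤ ys j) →
          ∀ φopt : ℝ, IsLeast (φ₀ '' ZOEG.feasibleSet X φ) φopt →
            ∫ ω, φ₀ (zhat K ω).fst ∂P - φopt ≤ ε)) ∧
      -- oracle complexity `O(d ε⁻²)`
      (ε ≤ 1 → ∃ K : ℕ, 1 ≤ K ∧ ZOEG.iterBound (dx + dy) G L D M₁ M₂ ε ≤ K ∧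
        ∀ ω, ((alg K ω).queries (ZOEG.lagrangian φ₀ φ) : ℝ) ≤
          C * ((dx + dy : ℕ) : ℝ) / ε ^ 2) := by
  let B := 864 * G ^ 2 * D ^ 2 + (196 * (L ^ 4 * M₂ ^ 2 * D ^ 2) / (6 * G ^ 2)) ^ (1 / 3 : ℝ)
    + 4 * |L * M₁ * D|
  -- Four queries per iteration; the 1 absorbs rounding the iteration bound up to an integer.
  refine ⟨4 * (B + 1), ?_⟩
  intro dx dy X Y φ₀ φ hXc hXcv hYc hYcv hDiam _ _ hf xs ys hxs hys hsaddle r ρ hr hrρ hM₁ hM₂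
    hLip hSmooth z₀ hz₀ Ω _ P hP v w hv hw hind ε hε alg zhat
  have hρ : 0 < ρ := (hr 0).trans_le (hrρ 0)
  have hZ := ZOEG.isCompact_prodSet hXc hYc
  have hcv := ZOEG.convex_prodSet hXcv hYcv
  have hne : (ZOEG.prodSet X Y).Nonempty := ⟨_, hz₀⟩
  have hcl := hZ.isClosed
  have hdiam : ∀ z₁ ∈ ZOEG.prodSet X Y, ∀ z₂ ∈ ZOEG.prodSet X Y, ‖z₁ - z₂‖ ≤ D := by
    intro z₁ h₁ z₂ h₂
    rw [← dist_eq_norm, ← hDiam]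
    exact Metric.dist_le_diam_of_mem hZ.isBounded h₁ h₂
  have hprob : IsProbabilityMeasure (ZOEG.uniformSphere dx dy) := by
    rw [← (hv 0).map_eq]
    exact Measure.isProbabilityMeasure_map (hv 0).aemeasurable
  have hμ := ZOEG.isRotationInvariantOnSphere_uniformSphere hprob
  choose v' hv'm hv'1 hv'ae using fun k => ZOEG.exists_unit_modification hμ (hv k)
  choose w' hw'm hw'1 hw'ae using fun k => ZOEG.exists_unit_modification hμ (hw k)
  -- In dimension 0 there is no unit vector, so the uniform law could not be a probability measure.
  have hd : 1 ≤ dx + dy := by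
    rw [← ZOEG.finrank_PD, Nat.one_le_iff_ne_zero, Ne, Module.finrank_zero_iff]
    intro hsub
    obtain ⟨e, he⟩ := hμ.norm_eq_one.exists
    rw [Subsingleton.elim e 0, norm_zero] at he
    exact zero_ne_one he
  have hind' : iIndepFun (Sum.elim v' w') P := by
    refine hind.congr ?_
    rintro (k | k)
    exacts [hv'ae k, hw'ae k]
  have hreg := ZOEG.isRegularNear_of_lipschitzFunOn hG hρ hLip hSmooth
  -- A global continuous extension makes the modified run measurable; almost surely it produces the
  -- same output.
  obtain ⟨h, hhLip, hfh₀⟩ := LipschitzOnWith.extend_real (K := ⟨G, hG.le⟩)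
    (f := ZOEG.lagrangian φ₀ φ) (s := Metric.cthickening ρ (ZOEG.prodSet X Y))
    (LipschitzOnWith.of_dist_le_mul fun x hx y hy => by
      rw [Real.dist_eq, dist_eq_norm]
      exact hLip x hx y hy)
  have hh := hhLip.continuous
  have hfh : ∀ z ∈ ZOEG.prodSet X Y, ∀ x ∈ Metric.closedBall z ρ,
      ZOEG.lagrangian φ₀ φ x = h x := fun z hz x hx =>
    hfh₀ (Metric.closedBall_subset_cthickening hz ρ hx)
  refine ⟨fun K hK1 hK => ?_, fun hε1 => ?_⟩
  · set y : Ω → ZOEG.PD dx dy := fun ω => (K : ℝ)⁻¹ • ∑ i ∈ Finset.range K,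
      ZOEG.iteratePlus h (ZOEG.prodSet X Y) (ZOEG.stepSize (dx + dy) K G D) r z₀
        (fun i => v' i ω) (fun i => w' i ω) i with hy
    have hym : Measurable y :=
      (continuous_const_smul (K : ℝ)⁻¹).measurable.comp
        (Finset.measurable_sum _ fun i _ => ZOEG.measurable_iteratePlus hne hcl hcv hh i
          (fun i _ => hv'm i) (fun i _ => hw'm i))
    have hyZ : ∀ ω, y ω ∈ ZOEG.prodSet X Y := fun ω =>
      ZOEG.average_mem hcv hK1 fun i => ZOEG.extrapolate_mem hne hcl hcv _ _
    have hzy : zhat K =ᵐ[P] y := by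
      filter_upwards [ae_all_iff.2 hv'ae, ae_all_iff.2 hw'ae] with ω h1 h2
      simp only [zhat, alg, hy, h1, h2, ZOEG.result_zoeg]
      congr 1
      refine Finset.sum_congr rfl fun i _ => ?_
      refine (ZOEG.iterate_congr hne hcl hcv hz₀
        (fun z hz => hfh z hz z (Metric.mem_closedBall_self hρ.le))
        (fun z hz k v hv => hfh z hz _ (Metric.closedBall_subset_closedBall (hrρ k)
          (ZOEG.add_smul_mem_closedBall (hr k).le hv.le)))
        (fun k => hv'1 k ω) (fun k => hw'1 k ω) i).2
    refine ZOEG.guarantees_of_integral_gap_le hXc hYc hρ hh hfh hxs hys hsaddle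
      (hym.aemeasurable.congr hzy.symm) (hzy.mono fun ω hω => hω ▸ hyZ ω) hε fun u hu => ?_
    have h1 : ∫ ω, ZOEG.gap (ZOEG.lagrangian φ₀ φ) u (zhat K ω) ∂P
        = ∫ ω, ZOEG.gap (ZOEG.lagrangian φ₀ φ) u (y ω) ∂P :=
      integral_congr_ae (hzy.mono fun ω hω => by simp only [hω])
    rw [h1]
    refine ZOEG.integral_gap_average_le hXc hXcv hYc hYcv hf hdiam hreg hG hL hr hrρ hM₁ hM₂ hh
      hfh hμ hd hv'm hw'm hv'1 hw'1 (fun k => ?_) (fun k => ?_) hind' hz₀ hu (fun z hz => ?_)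
      hε hK1 hK
    · rw [← (hv k).map_eq, Measure.map_congr (hv'ae k)]
    · rw [← (hw k).map_eq, Measure.map_congr (hw'ae k)]
    · have hself := fun z (hz : z ∈ ZOEG.prodSet X Y) =>
        Metric.closedBall_subset_cthickening hz ρ (Metric.mem_closedBall_self hρ.le)
      have h2 : ZOEG.mk z.fst u.snd ∈ ZOEG.prodSet X Y := ⟨hz.1, hu.2⟩
      have h3 : ZOEG.mk u.fst z.snd ∈ ZOEG.prodSet X Y := ⟨hu.1, hz.2⟩
      calc _ ≤ _ := le_abs_self _
        _ ≤ _ := hLip _ (hself _ h2) _ (hself _ h3)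
        _ ≤ G * D := mul_le_mul_of_nonneg_left (hdiam _ h2 _ h3) hG.le
  · have hb := ZOEG.iterBound_le hd (L := L) (D := D) (M₁ := M₁) (M₂ := M₂) hG hε hε1
    have hB : 0 ≤ B := by
      have : 0 ≤ (196 * (L ^ 4 * M₂ ^ 2 * D ^ 2) / (6 * G ^ 2)) ^ (1 / 3 : ℝ) :=
        Real.rpow_nonneg (by positivity) _
      positivity
    have hd' : (1 : ℝ) ≤ (dx + dy : ℕ) := by exact_mod_cast hd
    have hq : 1 ≤ ((dx + dy : ℕ) : ℝ) / ε ^ 2 := by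
      rw [one_le_div (by positivity)]
      exact (pow_le_one₀ hε.le hε1).trans hd'
    have hb0 : 0 ≤ ZOEG.iterBound (dx + dy) G L D M₁ M₂ ε :=
      le_max_of_le_left (le_max_of_le_left (by positivity))
    -- The maximum with 1 is needed because the bound can vanish, for instance when D = 0.
    refine ⟨max 1 ⌈ZOEG.iterBound (dx + dy) G L D M₁ M₂ ε⌉₊, le_max_left _ _, ?_, fun ω => ?_⟩
    · exact (Nat.le_ceil _).trans (by exact_mod_cast le_max_right _ _)
    · simp only [alg, ZOEG.queries_zoeg]
      have h1 : ((max 1 ⌈ZOEG.iterBound (dx + dy) G L D M₁ M₂ ε⌉₊ : ℕ) : ℝ)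
          ≤ ZOEG.iterBound (dx + dy) G L D M₁ M₂ ε + 1 := by
        rw [Nat.cast_max, Nat.cast_one]
        exact max_le (by linarith) (Nat.ceil_lt_add_one hb0).le
      rw [Nat.cast_mul, Nat.cast_ofNat, mul_div_assoc]
      linarith
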